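/- "Group" means abelian group. A group $A$ is *$\aleph_1$-free* if every countable subgroup of $A$ is free, and *strongly $\aleph_1$-free* if every countable subset of $A$ is contained in a free subgroup $B$ such that $A/B$ is $\aleph_1$-free. $A$ is a *Whitehead group* if $\operatorname{Ext}(A,\mathbb Z)=0$, and *$\aleph_1$-coseparable* if $\operatorname{Ext}(A,\mathbb Z^{(\omega)})=0$, where $\mathbb Z^{(\omega)}$ is the direct sum of countably many copies of $\mathbb Z$. Let $\lim(\omega_1)$ be the set of nonzero limit ordinals below $\omega_1$. For $S\subseteq\lim(\omega_1)$, a *ladder system* on $S$ is a family $\eta=(\eta_\delta)_{\delta\in S}$ of strictly increasing functions $\eta_\delta:\omega\to\delta$ with range cofinal in $\delta$. For $\lambda\in\{2,\omega\}$, $\eta$ *satisfies $\lambda$-uniformization* if for every family $(c_\delta)_{\delta\in S}$ of functions $c_\delta:\omega\to\lambda$ there are $f:\omega_1\to\lambda$ and $f^*:S\to\omega$ such that $f(\eta_\delta(n))=c_\delta(n)$ for all $\delta\in S$ and all $n\ge f^*(\delta)$. **Theorem.** Consider the following statements. 1. Every strongly $\aleph_1$-free group of cardinality $\aleph_1$ is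 $\aleph_1$-coseparable. 2. Every strongly $\aleph_1$-free group of cardinality $\aleph_1$ is a Whitehead group. 3. For every stationary $S\subseteq\omega_1$ with $S\subseteq\lim(\omega_1)$, every ladder system on $S$ satisfies $2$-uniformization. 4. For every stationary $S\subseteq\omega_1$ with $S\subseteq\lim(\omega_1)$, every ladder system on $S$ satisfies $\omega$-uniformization. 5. There is a strongly $\aleph_1$-free group of cardinality $\aleph_1$ which is $\aleph_1$-coseparable but not free. Then (1) $\Rightarrow$ (2) $\Rightarrow$ (3) $\Leftrightarrow$ (4) $\Rightarrow$ (5) (in ZFC). -/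

import Mathlib

/-- The first uncountable ordinal `ω₁`, as the linearly ordered type of all countable ordinals. -/
abbrev OmegaOne : Type 1 := Set.Iio (Ordinal.omega.{0} 1)

/-- `lim(ω₁)`: the (nonzero) limit ordinals below `ω₁`. -/
def limOmegaOne : Set OmegaOne := {δ | Order.IsSuccLimit δ.1}

/-- A ladder on `δ`: a strictly increasing function from `ω` to `δ` with range cofinal in `δ`. -/
structure IsLadder (δ : OmegaOne) (e : ℕ → OmegaOne) : Prop where
  strictMono : StrictMono e
  lt : ∀ n, e n < δ
  cofinal : ∀ α < δ, ∃ n, α ≤ e n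

/-- A ladder system on `S`: a family consisting of a ladder on `δ` for each `δ ∈ S`. -/
def IsLadderSystem (S : Set OmegaOne) (η : S → ℕ → OmegaOne) : Prop :=
  ∀ δ : S, IsLadder δ (η δ)

/-- The pair `⟨f, fs⟩` is a uniformization of the coloring `c` of `η`;
`L` is the set of colors. -/
def IsUniformization {S : Set OmegaOne} {L : Type} (η : S → ℕ → OmegaOne) (c : S → ℕ → L)
    (f : OmegaOne → L) (fs : S → ℕ) : Prop :=
  ∀ δ : S, ∀ n, fs δ ≤ n → f (η δ n) = c δ n

/-- `η` satisfies `L`-uniformization: every coloring of `η` with colors in `L` can be uniformized.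
`L = Fin 2` gives `2`-uniformization, `L = ℕ` gives `ω`-uniformization. -/
def SatisfiesUniformization {S : Set OmegaOne} (η : S → ℕ → OmegaOne) (L : Type) : Prop :=
  ∀ c : S → ℕ → L, ∃ (f : OmegaOne → L) (fs : S → ℕ), IsUniformization η c f fs

/-- Every ladder system on every stationary subset of `lim(ω₁)` satisfies `L`-uniformization. -/
def AllLadderSystemsUniformize (L : Type) : Prop :=
  ∀ S : Set OmegaOne, S ⊆ limOmegaOne → IsStationary S →
    ∀ η : S → ℕ → OmegaOne, IsLadderSystem S η → SatisfiesUniformization η L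

/-- An abelian group is `ℵ₁`-free if all its countable subgroups are free. -/
def IsAlephOneFree (A : Type) [AddCommGroup A] : Prop :=
  ∀ B : AddSubgroup A, Countable B → Module.Free ℤ B

/-- An abelian group `A` is strongly `ℵ₁`-free if every countable subset is contained in a free
subgroup `B` such that `A / B` is `ℵ₁`-free. -/
def IsStronglyAlephOneFree (A : Type) [AddCommGroup A] : Prop :=
  ∀ X : Set A, X.Countable →
    ∃ B : AddSubgroup A, X ⊆ B ∧ Module.Free ℤ B ∧ IsAlephOneFree (A ⧸ B)

/-- Whitehead groups: `Ext(A, ℤ) = 0`. -/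
def IsWhitehead (A : Type) [AddCommGroup A] : Prop :=
  Subsingleton (CategoryTheory.Abelian.Ext (ModuleCat.of ℤ A) (ModuleCat.of ℤ ℤ) 1)

/-- `ℵ₁`-coseparable groups: `Ext(A, ℤ^(ω)) = 0`, where `ℤ^(ω)` is the direct sum of countably
many copies of `ℤ`. -/
def IsAlephOneCoseparable (A : Type) [AddCommGroup A] : Prop :=
  Subsingleton (CategoryTheory.Abelian.Ext (ModuleCat.of ℤ A) (ModuleCat.of ℤ (ℕ →₀ ℤ)) 1)

/-- Every strongly `ℵ₁`-free group of cardinality `ℵ₁` is `ℵ₁`-coseparable. -/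
def AllCoseparable : Prop :=
  ∀ (A : Type) [AddCommGroup A], Cardinal.mk A = Cardinal.aleph 1 →
    IsStronglyAlephOneFree A → IsAlephOneCoseparable A

/-- Every strongly `ℵ₁`-free group of cardinality `ℵ₁` is a Whitehead group. -/
def AllWhitehead : Prop :=
  ∀ (A : Type) [AddCommGroup A], Cardinal.mk A = Cardinal.aleph 1 →
    IsStronglyAlephOneFree A → IsWhitehead A

/-- There is a strongly `ℵ₁`-free group of cardinality `ℵ₁` which is `ℵ₁`-coseparable but
not free. -/
def ExistsNonfreeCoseparable : Prop :=
  ∃ (A : Type) (_ : AddCommGroup A), Cardinal.mk A = Cardinal.aleph 1 ∧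
    IsStronglyAlephOneFree A ∧ IsAlephOneCoseparable A ∧ ¬ Module.Free ℤ A

/-! (1) ⇒ (2) holds because ℤ is a retract of ℤ^(ω). The other implications that involve groups use
one construction. A ladder system yields a group with a generator x_α for each α < ω₁ and, for each
δ, auxiliary generators tied by countably many relations to the x's on the ladder of δ. A
homomorphism from the subgroup of relators to G extends to the free group exactly when an
inhomogeneous system with these left-hand sides is solvable in G for all δ at once. So vanishing of
Ext becomes solvability.

Two conditions on the relations of a single ladder make the group strongly ℵ₁-free
(`IsTame.isStronglyAlephOneFree`). `TailSolvable` lets countably many almost disjoint ladders be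
treated one after another, since each meets the earlier ones in a finite set. `RationallySolvable`
takes care of the uncountably many other ladders by passing to rational coefficients.

(2) ⇒ (3): to read a colour off the integer f(α), let f(α) be congruent to y_δ or to y_δ - ⌊p/2⌋
modulo a prime p, according to the colour. For large p this depends on f(α) and p only, so p must be
determined by α and be unbounded along each ladder. A first application of (2), with relations for
all pairs of points of a ladder, produces a map ω₁ → ℕ injective on a tail of every ladder; it
indexes the primes used in a second application.

(3) ⇒ (4): a natural number c is coded in unary, by replacing each ladder point with c + 1 points
nearby. (4) ⇒ (5): with relations 2y_{n+1} = y_n - x_n, uniformizing colours in a countable group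
solves the systems there, while a closing-off argument shows that the group is not free. -/

open CategoryTheory Abelian

/-! ### Subgroups of free abelian groups. -/

/-- A subgroup of the free abelian group on a well-ordered set is free. -/
theorem free_addSubgroup_finsupp {I : Type*} [LinearOrder I] [WellFoundedLT I]
    (N : AddSubgroup (I →₀ ℤ)) : Module.Free ℤ N := by
  classical
  -- The leading coefficients at `i` of the elements of `N` supported on indices `≤ i`. Elements of
  -- `N` realizing the nonzero generators of these ideals will form a basis.
  let ideal : I → AddSubgroup ℤ := fun i =>
    (N ⊓ ⨅ j ∈ Set.Ioi i, (Finsupp.applyAddHom (M := ℤ) j).ker).map (Finsupp.applyAddHom i)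
  have hmem : ∀ i z, z ∈ ideal i ↔ ∃ v ∈ N, (∀ j, i < j → v j = 0) ∧ v i = z := by
    intro i z
    simp [ideal, AddSubgroup.mem_map, AddSubgroup.mem_inf, AddSubgroup.mem_iInf,
      AddMonoidHom.mem_ker, and_assoc]
  have hcyc : ∀ i, ∃ a : ℤ, ∀ z, z ∈ ideal i ↔ a ∣ z := by
    intro i
    obtain ⟨a, ha⟩ := Int.subgroup_cyclic (ideal i)
    refine ⟨a, fun z => ?_⟩
    rw [ha, ← AddSubgroup.zmultiples_eq_closure, Int.mem_zmultiples_iff]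
  choose a ha using hcyc
  have hgen : ∀ i, ∃ v ∈ N, (∀ j, i < j → v j = 0) ∧ v i = a i := fun i =>
    (hmem i _).1 ((ha i _).2 dvd_rfl)
  choose b hbN hbtop hba using hgen
  let J : Type _ := {i // a i ≠ 0}
  let B : J → N := fun i => ⟨b i, hbN i⟩
  have hli : LinearIndependent ℤ B := by
    rw [linearIndependent_iff]
    intro l hl
    by_contra hne
    have hs : l.support.Nonempty := Finsupp.support_nonempty_iff.2 hne
    set i := l.support.max' hs with hi
    have hil : l i ≠ 0 := Finsupp.mem_support_iff.1 (l.support.max'_mem hs)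
    have h1 : (((Finsupp.linearCombination ℤ B l : N) : I →₀ ℤ)) i.1 = 0 := by rw [hl]; rfl
    rw [Finsupp.linearCombination_apply, Finsupp.sum, AddSubgroup.val_finsetSum,
      Finsupp.finsetSum_apply, Finset.sum_eq_single i] at h1
    · have : l i * a i = 0 := by simpa [B, hba] using h1
      exact (mul_ne_zero hil i.2) this
    · intro j hj hji
      have hlt : j.1 < i.1 := lt_of_le_of_ne (l.support.le_max' j hj) (fun h => hji (Subtype.ext h))
      simp [B, hbtop j.1 _ hlt]
    · intro h; exact absurd (l.support.max'_mem hs) h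
  have hspan : ∀ i (v : N), (∀ j, i < j → v.1 j = 0) →
      v ∈ Submodule.span ℤ (Set.range B) := by
    intro i
    induction i using WellFoundedLT.induction with
    | ind i ih =>
      intro v hv
      have hdvd : a i ∣ v.1 i := (ha i _).1 ((hmem i _).2 ⟨v, v.2, hv, rfl⟩)
      obtain ⟨t, ht⟩ := hdvd
      -- Once the coefficient at `i` is cancelled, the leading index drops and the induction
      -- hypothesis applies.
      have key : ∀ w : N, (∀ j, i ≤ j → w.1 j = 0) → w ∈ Submodule.span ℤ (Set.range B) := by
        intro w hw
        by_cases hw0 : w.1 = 0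
        · have : w = 0 := Subtype.ext hw0
          rw [this]; exact Submodule.zero_mem _
        · have hs : w.1.support.Nonempty := Finsupp.support_nonempty_iff.2 hw0
          refine ih (w.1.support.max' hs) ?_ w ?_
          · by_contra h
            exact Finsupp.mem_support_iff.1 (w.1.support.max'_mem hs) (hw _ (not_lt.1 h))
          · intro j hj
            by_contra h
            exact absurd (w.1.support.le_max' j (Finsupp.mem_support_iff.2 h)) (not_le.2 hj)
      by_cases hai : a i = 0
      · refine key v fun j hj => ?_
        rcases hj.eq_or_lt with rfl | hj
        · rw [ht, hai, zero_mul]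
        · exact hv j hj
      · have hB : B ⟨i, hai⟩ ∈ Submodule.span ℤ (Set.range B) := Submodule.subset_span ⟨_, rfl⟩
        have : v - t • B ⟨i, hai⟩ ∈ Submodule.span ℤ (Set.range B) := by
          refine key _ fun j hj => ?_
          rcases hj.eq_or_lt with rfl | hj
          · simp [B, hba, ht, mul_comm]
          · simp [B, hv j hj, hbtop i j hj]
        simpa using Submodule.add_mem _ this (Submodule.smul_mem _ t hB)
  have htop : ⊤ ≤ Submodule.span ℤ (Set.range B) := by
    intro v _
    by_cases hv0 : v.1 = 0
    · have : v = 0 := Subtype.ext hv0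
      rw [this]; exact Submodule.zero_mem _
    · have hs : v.1.support.Nonempty := Finsupp.support_nonempty_iff.2 hv0
      refine hspan (v.1.support.max' hs) v fun j hj => ?_
      by_contra h
      exact absurd (v.1.support.le_max' j (Finsupp.mem_support_iff.2 h)) (not_le.2 hj)
  exact Module.Free.of_basis (Module.Basis.mk hli htop)

/-- An abelian group that embeds into a free abelian group is free. -/
theorem free_of_injective_addMonoidHom {I : Type*} {M : Type*} [AddCommGroup M]
    (f : M →+ (I →₀ ℤ)) (hf : Function.Injective f) : Module.Free ℤ M := by
  obtain ⟨_, _⟩ := exists_wellFoundedLT I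
  have := free_addSubgroup_finsupp f.range
  exact Module.Free.of_equiv (AddMonoidHom.ofInjective hf).symm.toIntLinearEquiv

/-! ### Vanishing of Ext as extension of homomorphisms. -/

section Ext

variable {F : Type} [AddCommGroup F] (K : AddSubgroup F)

/-- The short exact sequence `0 → K → F → F / K → 0` of abelian groups. -/
noncomputable def quotientShortComplex : ShortComplex (ModuleCat.{0} ℤ) :=
  ShortComplex.mk (ModuleCat.ofHom K.subtype.toIntLinearMap)
    (ModuleCat.ofHom (QuotientAddGroup.mk' K).toIntLinearMap) (by
      ext x
      simp)

theorem quotientShortComplex_shortExact : (quotientShortComplex K).ShortExact where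
  exact := by
    rw [ShortComplex.moduleCat_exact_iff]
    intro (x : F) (hx : (QuotientAddGroup.mk x : F ⧸ K) = 0)
    exact ⟨⟨x, (QuotientAddGroup.eq_zero_iff x).1 hx⟩, rfl⟩
  mono_f := by
    rw [ModuleCat.mono_iff_injective]
    exact Subtype.val_injective
  epi_g := by
    rw [ModuleCat.epi_iff_surjective]
    exact Quotient.mk_surjective

theorem exists_extension_of_subsingleton_ext {G : Type} [AddCommGroup G]
    (h : Subsingleton (Ext (ModuleCat.of ℤ (F ⧸ K)) (ModuleCat.of ℤ G) 1)) (φ : K →+ G) :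
    ∃ ψ : F →+ G, ∀ k : K, ψ k = φ k := by
  have hS := quotientShortComplex_shortExact K
  obtain ⟨x, hx⟩ := Ext.contravariant_sequence_exact₁ hS (ModuleCat.of ℤ G)
    (Ext.mk₀ (ModuleCat.ofHom φ.toIntLinearMap : (quotientShortComplex K).X₁ ⟶ _))
    (n₁ := 1) rfl (h.elim _ _)
  obtain ⟨ψ, rfl⟩ := (Ext.mk₀_bijective _ _).2 x
  rw [Ext.mk₀_comp_mk₀] at hx
  have := (Ext.mk₀_bijective _ _).1 hx
  refine ⟨ψ.hom.toAddMonoidHom, fun k => ?_⟩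
  exact congrArg (fun f => f.hom k) this

theorem subsingleton_ext_of_exists_extension {G : Type} [AddCommGroup G] [Module.Free ℤ F]
    (h : ∀ φ : K →+ G, ∃ ψ : F →+ G, ∀ k : K, ψ k = φ k) :
    Subsingleton (Ext (ModuleCat.of ℤ (F ⧸ K)) (ModuleCat.of ℤ G) 1) := by
  have hS := quotientShortComplex_shortExact K
  have : Projective (quotientShortComplex K).X₂ := ModuleCat.projective_of_free
      (Module.Free.chooseBasis ℤ F)
  refine subsingleton_of_forall_eq 0 fun x => ?_
  obtain ⟨y, hy⟩ := Ext.contravariant_sequence_exact₃ hS (ModuleCat.of ℤ G) x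
    (Ext.eq_zero_of_projective _) (n₀ := 0) rfl
  obtain ⟨φ, rfl⟩ := (Ext.mk₀_bijective _ _).2 y
  obtain ⟨ψ, hψ⟩ := h φ.hom.toAddMonoidHom
  obtain ⟨χ, hφ⟩ : ∃ χ : (quotientShortComplex K).X₂ ⟶ ModuleCat.of ℤ G,
      φ = (quotientShortComplex K).f ≫ χ :=
    ⟨ModuleCat.ofHom ψ.toIntLinearMap, by ext k; exact (hψ k).symm⟩
  rw [← hy, hφ, ← Ext.mk₀_comp_mk₀, hS.extClass_comp_assoc]
  rfl

end Ext

/-- ℤ is a direct summand of ℤ^(ω), so Ext(A, ℤ) embeds in Ext(A, ℤ^(ω)). -/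
theorem IsAlephOneCoseparable.isWhitehead {A : Type} [AddCommGroup A]
    (h : IsAlephOneCoseparable A) : IsWhitehead A := by
  let i : ModuleCat.of ℤ ℤ ⟶ ModuleCat.of ℤ (ℕ →₀ ℤ) := ModuleCat.ofHom (Finsupp.lsingle 0)
  let p : ModuleCat.of ℤ (ℕ →₀ ℤ) ⟶ ModuleCat.of ℤ ℤ := ModuleCat.ofHom (Finsupp.lapply 0)
  have hip : i ≫ p = 𝟙 _ := by
    ext
    simp [i, p]
  refine subsingleton_of_forall_eq 0 fun x => ?_
  have h0 : x.comp (Ext.mk₀ i) (add_zero 1) = 0 := h.elim _ _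
  have h1 : (x.comp (Ext.mk₀ i) (add_zero 1)).comp (Ext.mk₀ p) (add_zero 1) = x := by
    rw [Ext.comp_assoc_of_third_deg_zero, Ext.mk₀_comp_mk₀, hip, Ext.comp_mk₀_id]
  rw [← h1, h0, Ext.zero_comp]

/-! ### Systems of equations along ladders. -/

/-- Dependent choice along a well-founded relation. -/
theorem exists_wellFounded_choice {T β : Type*} {r : T → T → Prop} (hr : WellFounded r)
    (P : (d : T) → ((d' : T) → r d' d → β) → β → Prop) (hP : ∀ d prev, ∃ b, P d prev b) :
    ∃ s : T → β, ∀ d, P d (fun d' _ => s d') (s d) := by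
  choose Φ hΦ using hP
  refine ⟨hr.fix Φ, fun d => ?_⟩
  have := hΦ d (fun d' _ => hr.fix Φ d')
  rwa [← hr.fix_eq Φ d] at this

/-- Evaluation of a formal combination of two sequences of unknowns. -/
noncomputable def relEval {G : Type*} [AddCommGroup G] (ξ ζ : ℕ → G) : (ℕ ⊕ ℕ →₀ ℤ) →+ G :=
  (Finsupp.linearCombination ℤ (Sum.elim ξ ζ)).toAddMonoidHom

section relEval

variable {G H : Type*} [AddCommGroup G] [AddCommGroup H]

@[simp]
theorem relEval_single_inl (ξ ζ : ℕ → G) (i : ℕ) (z : ℤ) :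
    relEval ξ ζ (Finsupp.single (Sum.inl i) z) = z • ξ i := by
  simp [relEval]

@[simp]
theorem relEval_single_inr (ξ ζ : ℕ → G) (i : ℕ) (z : ℤ) :
    relEval ξ ζ (Finsupp.single (Sum.inr i) z) = z • ζ i := by
  simp [relEval]

theorem relEval_map (φ : G →+ H) (ξ ζ : ℕ → G) (r : ℕ ⊕ ℕ →₀ ℤ) :
    relEval (fun i => φ (ξ i)) (fun i => φ (ζ i)) r = φ (relEval ξ ζ r) := by
  suffices h : relEval (fun i => φ (ξ i)) (fun i => φ (ζ i)) = φ.comp (relEval ξ ζ) from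
    DFunLike.congr_fun h r
  ext i
  cases i <;> simp

theorem relEval_sub (ξ ζ ξ' ζ' : ℕ → G) (r : ℕ ⊕ ℕ →₀ ℤ) :
    relEval (fun i => ξ i - ξ' i) (fun i => ζ i - ζ' i) r = relEval ξ ζ r - relEval ξ' ζ' r := by
  suffices h : relEval (fun i => ξ i - ξ' i) (fun i => ζ i - ζ' i) =
      relEval ξ ζ - relEval ξ' ζ' from DFunLike.congr_fun h r
  ext i
  cases i <;> simp

theorem relEval_zero (r : ℕ ⊕ ℕ →₀ ℤ) :
    relEval (fun _ => (0 : G)) (fun _ => (0 : G)) r = 0 := by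
  suffices h : relEval (fun _ => (0 : G)) (fun _ => (0 : G)) = 0 from DFunLike.congr_fun h r
  ext i
  cases i <;> simp

end relEval

/-- Every system with left-hand sides `R` has a solution in every abelian group, with finitely
many of the first unknowns prescribed. -/
def TailSolvable (R : ℕ → ℕ ⊕ ℕ →₀ ℤ) : Prop :=
  ∀ (G : Type) [AddCommGroup G] (N : ℕ) (ξ₀ c : ℕ → G),
    ∃ ξ ζ : ℕ → G, (∀ i < N, ξ i = ξ₀ i) ∧ ∀ m, relEval ξ ζ (R m) = c m

/-- Every system with left-hand sides `R` has a solution in every rational vector space, with all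
of the first unknowns prescribed. -/
def RationallySolvable (R : ℕ → ℕ ⊕ ℕ →₀ ℤ) : Prop :=
  ∀ (V : Type) [AddCommGroup V] [Module ℚ V] (ξ c : ℕ → V),
    ∃ ζ : ℕ → V, ∀ m, relEval ξ ζ (R m) = c m

/-- Countably many systems along almost disjoint ladders can be solved simultaneously. -/
theorem exists_solution_of_countable {X T : Type} [Countable T] {G : Type} [AddCommGroup G]
    (lad : T → ℕ → X) (R : T → ℕ → ℕ ⊕ ℕ →₀ ℤ) (hinj : ∀ d, Function.Injective (lad d))
    (had : ∀ d d', d ≠ d' → {m | lad d m ∈ Set.range (lad d')}.Finite)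
    (X₀ : Set X) (hX₀ : ∀ d, {m | lad d m ∈ X₀}.Finite) (hR : ∀ d, TailSolvable (R d))
    (f₀ : X → G) (c : T → ℕ → G) :
    ∃ (f : X → G) (g : T → ℕ → G), (∀ x ∈ X₀, f x = f₀ x) ∧
      ∀ d m, relEval (fun i => f (lad d i)) (g d) (R d m) = c d m := by
  obtain ⟨ι, hι⟩ := Countable.exists_injective_nat T
  have hwf : WellFounded (fun d' d : T => ι d' < ι d) := (measure ι).wf
  -- The value at a point outside `X₀` is decided by the first ladder, in the enumeration `ι`, that
  -- passes through it.
  let owned : X → T → Prop := fun x d =>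
    x ∉ X₀ ∧ x ∈ Set.range (lad d) ∧ ∀ d', ι d' < ι d → x ∉ Set.range (lad d')
  have owned_unique : ∀ x d d', owned x d → owned x d' → d = d' := by
    intro x d d' h h'
    apply hι
    by_contra hne
    rcases lt_or_gt_of_ne hne with hlt | hlt
    · exact h'.2.2 d hlt h.2.1
    · exact h.2.2 d' hlt h'.2.1
  -- Only finitely many earlier ladders exist and each meets this one in a finite set. So the values
  -- already decided lie on an initial segment, as `TailSolvable` requires.
  have hbound : ∀ d, ∃ N, ∀ m, (lad d m ∈ X₀ ∨
      ∃ d', ι d' < ι d ∧ lad d m ∈ Set.range (lad d')) → m < N := by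
    intro d
    have hfin : ({m | lad d m ∈ X₀} ∪
        ⋃ d' ∈ {d' | ι d' < ι d}, {m | lad d m ∈ Set.range (lad d')}).Finite := by
      refine (hX₀ d).union (Set.Finite.biUnion ?_ ?_)
      · exact (Set.finite_Iio (ι d)).preimage hι.injOn
      · intro d' hd'
        exact had d d' (fun h => by subst h; exact lt_irrefl (ι d) hd')
    obtain ⟨N, hN⟩ := hfin.bddAbove
    refine ⟨N + 1, fun m hm => Nat.lt_succ_of_le (hN ?_)⟩
    rcases hm with hm | ⟨d', h, hm⟩
    · exact Or.inl hm
    · exact Or.inr (Set.mem_biUnion (x := d') h hm)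
  choose N hN using hbound
  obtain ⟨sol, hsol⟩ := exists_wellFounded_choice hwf
    (β := (ℕ → G) × (ℕ → G))
    (fun d prev b => (∀ m, relEval b.1 b.2 (R d m) = c d m) ∧
      ∀ i < N d, (lad d i ∈ X₀ → b.1 i = f₀ (lad d i)) ∧
        ∀ d' j (h : ι d' < ι d), owned (lad d i) d' → lad d' j = lad d i →
          b.1 i = (prev d' h).1 j) (by
      intro d prev
      have hξ : ∀ i, ∃ v : G, (lad d i ∈ X₀ → v = f₀ (lad d i)) ∧
          ∀ d' j (h : ι d' < ι d), owned (lad d i) d' → lad d' j = lad d i →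
          v = (prev d' h).1 j := by
        intro i
        by_cases h0 : lad d i ∈ X₀
        · exact ⟨f₀ (lad d i), fun _ => rfl, fun d' j h ho _ => absurd h0 ho.1⟩
        · by_cases h1 : ∃ d' j, ι d' < ι d ∧ owned (lad d i) d' ∧ lad d' j = lad d i
          · obtain ⟨d₁, j₁, h₁, ho₁, hj₁⟩ := h1
            refine ⟨(prev d₁ h₁).1 j₁, fun h => absurd h h0, fun d' j h ho hj => ?_⟩
            obtain rfl := owned_unique _ _ _ ho₁ ho
            obtain rfl := hinj d₁ (hj₁.trans hj.symm)
            rfl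
          · exact ⟨0, fun h => absurd h h0,
              fun d' j h ho hj => absurd ⟨d', j, h, ho, hj⟩ h1⟩
      choose ξ₀ hξ₀ using hξ
      obtain ⟨ξ, ζ, hξ, hs⟩ := hR d G (N d) ξ₀ (c d)
      refine ⟨(ξ, ζ), hs, fun i hi => ?_⟩
      simp only [hξ i hi]
      exact hξ₀ i)
  have hf : ∀ x, ∃ v : G, (x ∈ X₀ → v = f₀ x) ∧
      ∀ d j, owned x d → lad d j = x → v = (sol d).1 j := by
    intro x
    by_cases h0 : x ∈ X₀
    · exact ⟨f₀ x, fun _ => rfl, fun d j ho _ => absurd h0 ho.1⟩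
    · by_cases h1 : ∃ d j, owned x d ∧ lad d j = x
      · obtain ⟨d₁, j₁, ho₁, hj₁⟩ := h1
        refine ⟨(sol d₁).1 j₁, fun h => absurd h h0, fun d j ho hj => ?_⟩
        obtain rfl := owned_unique _ _ _ ho₁ ho
        obtain rfl := hinj d₁ (hj₁.trans hj.symm)
        rfl
      · exact ⟨0, fun h => absurd h h0, fun d j ho hj => absurd ⟨d, j, ho, hj⟩ h1⟩
  choose f hf using hf
  refine ⟨f, fun d => (sol d).2, fun x hx => (hf x).1 hx, fun d m => ?_⟩
  have hfl : (fun i => f (lad d i)) = (sol d).1 := by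
    funext i
    by_cases h0 : lad d i ∈ X₀
    · rw [(hf _).1 h0, (((hsol d).2 i (hN d i (Or.inl h0))).1 h0)]
    · obtain ⟨d', hd', hmin⟩ := hwf.has_min {d' | lad d i ∈ Set.range (lad d')} ⟨d, i, rfl⟩
      have ho : owned (lad d i) d' := ⟨h0, hd', fun d'' hlt hmem => hmin d'' hmem hlt⟩
      by_cases hdd : d' = d
      · subst hdd
        exact (hf _).2 d' i ho rfl
      · have hlt : ι d' < ι d := by
          have := hmin d ⟨i, rfl⟩
          exact lt_of_le_of_ne (not_lt.1 this) (fun h => hdd (hι h))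
        obtain ⟨j, hj⟩ := hd'
        rw [(hf _).2 d' j ho hj,
          ((hsol d).2 i (hN d i (Or.inr ⟨d', hlt, j, hj⟩))).2 d' j hlt ho hj]
  rw [hfl]
  exact (hsol d).1 m

/-! ### Groups presented by ladders and their freeness. -/

/-- Generators and relations for an abelian group: for every `d : D` there is a sequence of
auxiliary generators, and relations between these and the generators on the ladder of `d`. -/
structure LadderPresentation (X D : Type) where
  ladder : D → ℕ → X
  rel : D → ℕ → ℕ ⊕ ℕ →₀ ℤ

namespace LadderPresentation

variable {X D : Type} (P : LadderPresentation X D)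

/-- The homomorphism on the free group given by its values on generators. -/
noncomputable def evalGens {G : Type*} [AddCommGroup G] (f : X → G) (g : D → ℕ → G) :
    (X ⊕ D × ℕ →₀ ℤ) →+ G :=
  (Finsupp.linearCombination ℤ (Sum.elim f fun p => g p.1 p.2)).toAddMonoidHom

@[simp]
theorem evalGens_single_inl {G : Type*} [AddCommGroup G] (f : X → G) (g : D → ℕ → G) (x : X)
    (z : ℤ) : evalGens f g (Finsupp.single (Sum.inl x) z) = z • f x := by
  simp [evalGens]

@[simp]
theorem evalGens_single_inr {G : Type*} [AddCommGroup G] (f : X → G) (g : D → ℕ → G)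
    (p : D × ℕ) (z : ℤ) :
    evalGens f g (Finsupp.single (Sum.inr p) z) = z • g p.1 p.2 := by
  simp [evalGens]

/-- The relators. -/
noncomputable def relator (d : D) (m : ℕ) : X ⊕ D × ℕ →₀ ℤ :=
  relEval (fun i => Finsupp.single (Sum.inl (P.ladder d i)) 1)
    (fun j => Finsupp.single (Sum.inr (d, j)) 1) (P.rel d m)

theorem evalGens_relator {G : Type*} [AddCommGroup G] (f : X → G) (g : D → ℕ → G) (d : D)
    (m : ℕ) :
    evalGens f g (P.relator d m) = relEval (fun i => f (P.ladder d i)) (g d) (P.rel d m) := by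
  rw [relator, ← relEval_map]
  simp

/-- The subgroup generated by the relators. -/
noncomputable def relators : AddSubgroup (X ⊕ D × ℕ →₀ ℤ) :=
  AddSubgroup.closure (Set.range fun p : D × ℕ => P.relator p.1 p.2)

theorem relator_mem (d : D) (m : ℕ) : P.relator d m ∈ P.relators :=
  AddSubgroup.subset_closure ⟨(d, m), rfl⟩

theorem relators_le_ker {G : Type*} [AddCommGroup G] (φ : (X ⊕ D × ℕ →₀ ℤ) →+ G)
    (h : ∀ d m, φ (P.relator d m) = 0) : P.relators ≤ φ.ker := by
  rw [relators, AddSubgroup.closure_le]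
  rintro _ ⟨p, rfl⟩
  exact h p.1 p.2

/-- The presented group. -/
abbrev Group : Type := (X ⊕ D × ℕ →₀ ℤ) ⧸ P.relators

/-- The subgroup of the free group generated by sets of generators. -/
noncomputable def genSpan (X₀ : Set X) (D₀ : Set D) : AddSubgroup (X ⊕ D × ℕ →₀ ℤ) :=
  AddSubgroup.closure ((fun i => Finsupp.single i 1) '' (Sum.inl '' X₀ ∪ Sum.inr '' (D₀ ×ˢ Set.univ)))

theorem single_inl_mem_genSpan {X₀ : Set X} (D₀ : Set D) {x : X} (hx : x ∈ X₀) :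
    Finsupp.single (Sum.inl x) 1 ∈ genSpan X₀ D₀ :=
  AddSubgroup.subset_closure ⟨_, Or.inl ⟨x, hx, rfl⟩, rfl⟩

theorem single_inr_mem_genSpan (X₀ : Set X) {D₀ : Set D} {d : D} (hd : d ∈ D₀) (j : ℕ) :
    Finsupp.single (Sum.inr (d, j)) 1 ∈ genSpan X₀ D₀ :=
  AddSubgroup.subset_closure ⟨_, Or.inr ⟨(d, j), ⟨hd, trivial⟩, rfl⟩, rfl⟩

theorem genSpan_induction {X₀ : Set X} {D₀ : Set D} {p : (X ⊕ D × ℕ →₀ ℤ) → Prop}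
    (inl : ∀ x ∈ X₀, p (Finsupp.single (Sum.inl x) 1))
    (inr : ∀ d ∈ D₀, ∀ j, p (Finsupp.single (Sum.inr (d, j)) 1))
    (zero : p 0) (add : ∀ v w, p v → p w → p (v + w)) (neg : ∀ v, p v → p (-v))
    {v : X ⊕ D × ℕ →₀ ℤ} (hv : v ∈ genSpan X₀ D₀) : p v := by
  induction hv using AddSubgroup.closure_induction with
  | mem v hv =>
    obtain ⟨_, ⟨x, hx, rfl⟩ | ⟨⟨d, j⟩, ⟨hd, -⟩, rfl⟩, rfl⟩ := hv
    · exact inl x hx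
    · exact inr d hd j
  | zero => exact zero
  | add v w _ _ hv hw => exact add v w hv hw
  | neg v _ hv => exact neg v hv

/-- Ladders with index in `D₀` lie in `X₀`, other ladders meet `X₀` in a finite set. -/
structure IsClosedPair (X₀ : Set X) (D₀ : Set D) : Prop where
  mem : ∀ d ∈ D₀, ∀ m, P.ladder d m ∈ X₀
  finite : ∀ d ∉ D₀, {m | P.ladder d m ∈ X₀}.Finite

theorem isClosedPair_empty : P.IsClosedPair ∅ ∅ where
  mem := by simp
  finite := by simp

/-- The conditions under which the presented group is strongly `ℵ₁`-free. -/
structure IsTame : Prop where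
  injective : ∀ d, Function.Injective (P.ladder d)
  almostDisjoint : ∀ d d', d ≠ d' → {m | P.ladder d m ∈ Set.range (P.ladder d')}.Finite
  exists_closed : ∀ (X₀ : Set X) (D₀ : Set D), X₀.Countable → D₀.Countable →
    ∃ X₁ D₁, X₁.Countable ∧ D₁.Countable ∧ X₀ ⊆ X₁ ∧ D₀ ⊆ D₁ ∧ P.IsClosedPair X₁ D₁
  tailSolvable : ∀ d, TailSolvable (P.rel d)
  rationallySolvable : ∀ d, RationallySolvable (P.rel d)

/-- The embedding of the free group into the rational vector space on the same generators. -/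
noncomputable def toRat (I : Type) : (I →₀ ℤ) →+ (I →₀ ℚ) :=
  Finsupp.mapRange.addMonoidHom (Int.castAddHom ℚ)

theorem toRat_injective (I : Type) : Function.Injective (toRat I) :=
  Finsupp.mapRange_injective _ rfl Int.cast_injective

variable {P}

/-- Modulo the relators and the generators in `X₀`, `D₀`, the part generated by `X₁`, `D₁` embeds in
a free group: there `σ` has integral values, and `σ v = 0` forces `w = 0`, hence `v ∈ P.relators ⊔
genSpan X₀ D₀`. The map is the identity minus a map into that subgroup which fixes the relators of
the ladders in `D₁` outside `D₀` and the generators in `X₀`. -/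
theorem IsTame.exists_section (hP : P.IsTame) {X₀ X₁ : Set X} {D₀ D₁ : Set D}
    (h₀ : P.IsClosedPair X₀ D₀) (hD₁ : D₁.Countable) :
    ∃ σ : (X ⊕ D × ℕ →₀ ℤ) →+ (X ⊕ D × ℕ →₀ ℚ), P.relators ≤ σ.ker ∧ genSpan X₀ D₀ ≤ σ.ker ∧
      ∀ v ∈ genSpan X₁ D₁, ∃ w, σ v = toRat _ w ∧ v - w ∈ P.relators ⊔ genSpan X₀ D₀ := by
  classical
  let T := {d // d ∈ D₁ ∧ d ∉ D₀}
  have : Countable T := (hD₁.mono (fun d (h : d ∈ D₁ ∧ d ∉ D₀) => h.1)).to_subtype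
  let G : AddSubgroup (X ⊕ D × ℕ →₀ ℤ) := P.relators ⊔ genSpan X₀ D₀
  have hG : ∀ v ∈ genSpan X₀ D₀, v ∈ G := fun v hv => (le_sup_right : _ ≤ G) hv
  have hKG : ∀ v ∈ P.relators, v ∈ G := fun v hv => (le_sup_left : _ ≤ G) hv
  obtain ⟨f, g, hf, hfg⟩ := exists_solution_of_countable (T := T) (G := G)
    (fun d => P.ladder d) (fun d => P.rel d) (fun d => hP.injective d)
    (fun d d' h => hP.almostDisjoint d d' (fun h' => h (Subtype.ext h'))) X₀
    (fun d => h₀.finite d d.2.2) (fun d => hP.tailSolvable d)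
    (fun x => if hx : x ∈ X₀ then ⟨_, hG _ (single_inl_mem_genSpan D₀ hx)⟩ else 0)
    (fun d m => ⟨_, hKG _ (P.relator_mem d m)⟩)
  have hfX : ∀ x ∈ X₀, (f x : X ⊕ D × ℕ →₀ ℤ) = Finsupp.single (Sum.inl x) 1 := by
    intro x hx
    rw [hf x hx, dif_pos hx]
  -- Both the generators and `f`, `g` solve the system whose right-hand sides are the relators, so
  -- their difference solves the homogeneous one.
  let s : X → X ⊕ D × ℕ →₀ ℚ := fun x => toRat _ (Finsupp.single (Sum.inl x) 1 - (f x).1)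
  have hζ := fun d => hP.rationallySolvable d (X ⊕ D × ℕ →₀ ℚ) (fun i => s (P.ladder d i)) 0
  choose ζ hζ using hζ
  -- Outside the countable set `D₁` integrality is not needed, and the rational solution `ζ` fits
  -- the values of `s` already fixed.
  let t : D → ℕ → X ⊕ D × ℕ →₀ ℚ := fun d j => if h₀ : d ∈ D₀ then 0 else
    if h₁ : d ∈ D₁ then toRat _ (Finsupp.single (Sum.inr (d, j)) 1 - (g ⟨d, h₁, h₀⟩ j).1) else ζ d j
  have hs : ∀ x ∈ X₀, s x = 0 := by
    intro x hx
    simp only [s, hfX x hx, sub_self, map_zero]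
  have ht : ∀ d ∈ D₀, t d = fun _ => 0 := by
    intro d hd
    funext j
    simp only [t, dif_pos hd]
  refine ⟨evalGens s t, ?_, ?_, ?_⟩
  · refine P.relators_le_ker _ fun d m => ?_
    rw [evalGens_relator]
    by_cases hd₀ : d ∈ D₀
    · rw [ht d hd₀, show (fun i => s (P.ladder d i)) = fun _ => 0 from
        funext fun i => hs _ (h₀.mem d hd₀ i), relEval_zero]
    by_cases hd₁ : d ∈ D₁
    · have htd : t d = fun j =>
          toRat _ (Finsupp.single (Sum.inr (d, j)) 1 - (g ⟨d, hd₁, hd₀⟩ j).1) := by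
        funext j
        simp only [t, dif_neg hd₀, dif_pos hd₁]
      rw [htd, relEval_map (toRat (X ⊕ D × ℕ)), relEval_sub]
      have h1 := congrArg G.subtype (hfg ⟨d, hd₁, hd₀⟩ m)
      rw [← relEval_map] at h1
      simp only [AddSubgroup.subtype_apply] at h1
      rw [h1, ← relator, sub_self, map_zero]
    · have htd : t d = ζ d := by
        funext j
        simp only [t, dif_neg hd₀, dif_neg hd₁]
      rw [htd, hζ]
      rfl
  · intro v hv
    refine genSpan_induction (p := fun v => v ∈ (evalGens s t).ker) ?_ ?_ (zero_mem _)
      (fun v w => add_mem) (fun v => neg_mem) hv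
    · intro x hx
      simp [AddMonoidHom.mem_ker, hs x hx]
    · intro d hd j
      simp [AddMonoidHom.mem_ker, ht d hd]
  · intro v hv
    refine genSpan_induction
      (p := fun v => ∃ w, evalGens s t v = toRat _ w ∧ v - w ∈ P.relators ⊔ genSpan X₀ D₀)
      ?_ ?_ ⟨0, by simp, by simp⟩ ?_ ?_ hv
    · intro x hx
      refine ⟨Finsupp.single (Sum.inl x) 1 - (f x).1, by simp [s], ?_⟩
      rw [sub_sub_cancel]
      exact (f x).2
    · intro d hd j
      by_cases hd₀ : d ∈ D₀
      · refine ⟨0, by simp [ht d hd₀], ?_⟩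
        rw [sub_zero]
        exact hG _ (single_inr_mem_genSpan _ hd₀ j)
      · refine ⟨Finsupp.single (Sum.inr (d, j)) 1 - (g ⟨d, hd, hd₀⟩ j).1, ?_, ?_⟩
        · simp [t, dif_neg hd₀, dif_pos hd]
        · rw [sub_sub_cancel]
          exact (g _ j).2
    · rintro v w ⟨v', hv', hv⟩ ⟨w', hw', hw⟩
      refine ⟨v' + w', by rw [map_add, map_add, hv', hw'], ?_⟩
      rw [add_sub_add_comm]
      exact add_mem hv hw
    · rintro v ⟨v', hv', hv⟩
      refine ⟨-v', by rw [map_neg, map_neg, hv'], ?_⟩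
      rw [← neg_sub']
      exact neg_mem hv

theorem mem_genSpan_of_support {X₀ : Set X} {D₀ : Set D} (v : X ⊕ D × ℕ →₀ ℤ)
    (hX : ∀ x, Sum.inl x ∈ v.support → x ∈ X₀)
    (hD : ∀ d j, Sum.inr (d, j) ∈ v.support → d ∈ D₀) : v ∈ genSpan X₀ D₀ := by
  rw [← Finsupp.sum_single v]
  refine sum_mem fun i hi => ?_
  have hz : Finsupp.single i (v i) = v i • Finsupp.single i (1 : ℤ) := by simp
  rw [hz]
  refine zsmul_mem ?_ _
  rcases i with x | ⟨d, j⟩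
  · exact single_inl_mem_genSpan _ (hX x hi)
  · exact single_inr_mem_genSpan _ (hD d j hi) j

theorem IsTame.exists_closed_genSpan (hP : P.IsTame) (C : Set (X ⊕ D × ℕ →₀ ℤ))
    (hC : C.Countable) :
    ∃ X₁ D₁, D₁.Countable ∧ P.IsClosedPair X₁ D₁ ∧ C ⊆ genSpan X₁ D₁ := by
  have hU : (⋃ v ∈ C, (v.support : Set (X ⊕ D × ℕ))).Countable :=
    hC.biUnion fun v _ => v.support.countable_toSet
  obtain ⟨X₁, D₁, -, hD₁, hX, hD, hcl⟩ := hP.exists_closed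
    (Sum.inl ⁻¹' ⋃ v ∈ C, (v.support : Set (X ⊕ D × ℕ)))
    (Prod.fst '' (Sum.inr ⁻¹' ⋃ v ∈ C, (v.support : Set (X ⊕ D × ℕ))))
    (hU.preimage Sum.inl_injective) ((hU.preimage Sum.inr_injective).image _)
  refine ⟨X₁, D₁, hD₁, hcl, fun v hv => mem_genSpan_of_support v ?_ ?_⟩
  · intro x hx
    exact hX (Set.mem_biUnion (x := v) hv hx)
  · intro d j hx
    exact hD ⟨(d, j), Set.mem_biUnion (x := v) hv hx, rfl⟩

theorem free_of_injective_toRat {M I : Type} [AddCommGroup M] (φ : M →+ (I →₀ ℚ))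
    (hφ : Function.Injective φ) (h : ∀ x, ∃ w, φ x = toRat I w) : Module.Free ℤ M := by
  let e := AddMonoidHom.ofInjective (toRat_injective I)
  let ψ : M →+ (toRat I).range := φ.codRestrict _ fun x => by
    obtain ⟨w, hw⟩ := h x
    exact ⟨w, hw.symm⟩
  refine free_of_injective_addMonoidHom (e.symm.toAddMonoidHom.comp ψ) ?_
  refine e.symm.injective.comp fun x y hxy => hφ ?_
  exact congrArg Subtype.val hxy

/-- `B` is generated by a countable closed pair containing representatives of the given set.
`IsTame.exists_section` over the empty pair shows that `B` is free, and over the pair of `B` that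
countable subgroups of the quotient are free. -/
theorem IsTame.isStronglyAlephOneFree (hP : P.IsTame) : IsStronglyAlephOneFree P.Group := by
  intro Y hY
  obtain ⟨X₁, D₁, hD₁, hcl, hsub₁⟩ := hP.exists_closed_genSpan (Quotient.out '' Y) (hY.image _)
  let B : AddSubgroup P.Group := (genSpan X₁ D₁).map (QuotientAddGroup.mk' P.relators)
  refine ⟨B, ?_, ?_, ?_⟩
  · intro y hy
    exact ⟨Quotient.out y, hsub₁ ⟨y, hy, rfl⟩, Quotient.out_eq y⟩
  · obtain ⟨σ, hσK, -, hσ⟩ := hP.exists_section P.isClosedPair_empty hD₁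
    let τ : P.Group →+ _ := QuotientAddGroup.lift P.relators σ hσK
    refine free_of_injective_toRat (τ.comp B.subtype) ?_ ?_
    · rw [injective_iff_map_eq_zero]
      rintro ⟨_, v, hv, rfl⟩ h0
      obtain ⟨w, hw, hvw⟩ := hσ v hv
      have hw0 : w = 0 := toRat_injective _ (by rw [← hw, map_zero]; exact h0)
      have hbot : genSpan (∅ : Set X) (∅ : Set D) = ⊥ := by simp [genSpan]
      rw [hw0, sub_zero, hbot, sup_bot_eq] at hvw
      exact Subtype.ext ((QuotientAddGroup.eq_zero_iff v).2 hvw)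
    · rintro ⟨_, v, hv, rfl⟩
      obtain ⟨w, hw, -⟩ := hσ v hv
      exact ⟨w, hw⟩
  · intro C hC
    obtain ⟨X₂, D₂, hD₂, -, hsub₂⟩ := hP.exists_closed_genSpan
      ((fun c : P.Group ⧸ B => Quotient.out (Quotient.out c)) '' C) ((Set.to_countable _).image _)
    obtain ⟨σ, hσK, hσ₁, hσ⟩ := hP.exists_section hcl hD₂
    let τ : P.Group →+ _ := QuotientAddGroup.lift P.relators σ hσK
    let ρ : P.Group ⧸ B →+ _ := QuotientAddGroup.lift B τ (by
      rintro _ ⟨v, hv, rfl⟩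
      exact hσ₁ hv)
    have hrep : ∀ c ∈ C, ∃ v ∈ genSpan X₂ D₂,
        ((v : P.Group) : P.Group ⧸ B) = c := by
      intro c hc
      refine ⟨_, hsub₂ ⟨c, hc, rfl⟩, ?_⟩
      have h1 : ((Quotient.out (Quotient.out c) : X ⊕ D × ℕ →₀ ℤ) : P.Group) = Quotient.out c :=
        Quotient.out_eq _
      rw [h1]
      exact Quotient.out_eq _
    refine free_of_injective_toRat (ρ.comp C.subtype) ?_ ?_
    · rw [injective_iff_map_eq_zero]
      rintro ⟨c, hc⟩ h0
      obtain ⟨v, hv, rfl⟩ := hrep c hc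
      obtain ⟨w, hw, hvw⟩ := hσ v hv
      have hw0 : w = 0 := toRat_injective _ (by rw [← hw, map_zero]; exact h0)
      rw [hw0, sub_zero] at hvw
      obtain ⟨k, hk, b, hb, rfl⟩ := AddSubgroup.mem_sup.1 hvw
      refine Subtype.ext ((QuotientAddGroup.eq_zero_iff _).2 ⟨b, hb, ?_⟩)
      rw [QuotientAddGroup.mk_add, (QuotientAddGroup.eq_zero_iff k).2 hk, zero_add]
      rfl
    · rintro ⟨c, hc⟩
      obtain ⟨v, hv, rfl⟩ := hrep c hc
      obtain ⟨w, hw, -⟩ := hσ v hv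
      exact ⟨w, hw⟩

theorem IsTame.mk_group (hP : P.IsTame) (hX : Cardinal.mk X = Cardinal.aleph 1)
    (hD : Cardinal.mk D ≤ Cardinal.aleph 1) : Cardinal.mk P.Group = Cardinal.aleph 1 := by
  refine le_antisymm ?_ ?_
  · refine (Cardinal.mk_le_of_surjective (QuotientAddGroup.mk'_surjective P.relators)).trans ?_
    have hI : Cardinal.mk (X ⊕ D × ℕ) ≤ Cardinal.aleph 1 := by
      simp only [Cardinal.mk_sum, Cardinal.mk_prod, Cardinal.lift_id, Cardinal.mk_nat, hX]
      have h1 := Cardinal.aleph0_le_aleph 1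
      exact Cardinal.add_le_of_le h1 le_rfl (Cardinal.mul_le_of_le h1 hD h1)
    have : Infinite X := by
      rw [Cardinal.infinite_iff, hX]
      exact Cardinal.aleph0_le_aleph 1
    rw [Cardinal.mk_finsupp_of_infinite]
    simp only [Cardinal.mk_int]
    exact max_le hI (Cardinal.aleph0_le_aleph 1)
  · rw [← hX]
    -- A homomorphism sending the generators `x` to independent vectors shows that they stay
    -- distinct in the group.
    have hζ := fun d => hP.rationallySolvable d (X →₀ ℚ)
      (fun i => Finsupp.single (P.ladder d i) 1) 0
    choose ζ hζ using hζ
    let σ : (X ⊕ D × ℕ →₀ ℤ) →+ (X →₀ ℚ) := evalGens (fun x => Finsupp.single x 1) ζ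
    have hσ : P.relators ≤ σ.ker := P.relators_le_ker _ fun d m => by
      rw [evalGens_relator, hζ]
      rfl
    refine Cardinal.mk_le_of_injective
      (f := fun x => ((Finsupp.single (Sum.inl x) 1 : X ⊕ D × ℕ →₀ ℤ) : P.Group)) fun x y h => ?_
    have h1 : σ (Finsupp.single (Sum.inl x) 1) = σ (Finsupp.single (Sum.inl y) 1) :=
      congrArg (QuotientAddGroup.lift P.relators σ hσ) h
    simp only [σ, evalGens_single_inl, one_smul] at h1
    exact Finsupp.single_left_injective one_ne_zero h1

/-- A rational solution with all ladder values zero defines a map to ℚ with value `c d m` on each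
relator. It is therefore integral on the relators, and the Whitehead property extends this
restriction to the free group over ℤ. -/
theorem IsTame.exists_solution_of_isWhitehead (hP : P.IsTame) (hW : IsWhitehead P.Group)
    (c : D → ℕ → ℤ) : ∃ (f : X → ℤ) (g : D → ℕ → ℤ),
      ∀ d m, relEval (fun i => f (P.ladder d i)) (g d) (P.rel d m) = c d m := by
  have hζ := fun d => hP.rationallySolvable d ℚ (fun _ => 0) (fun m => (c d m : ℚ))
  choose ζ hζ using hζ
  let σ : (X ⊕ D × ℕ →₀ ℤ) →+ ℚ := evalGens (fun _ => 0) ζ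
  have hσ : ∀ d m, σ (P.relator d m) = c d m := fun d m => by
    rw [evalGens_relator, hζ]
  let e := AddMonoidHom.ofInjective (f := Int.castAddHom ℚ) Int.cast_injective
  have hK : P.relators ≤ (Int.castAddHom ℚ).range.comap σ := by
    rw [relators, AddSubgroup.closure_le]
    rintro _ ⟨p, rfl⟩
    exact ⟨c p.1 p.2, (hσ p.1 p.2).symm⟩
  let φ : P.relators →+ ℤ := e.symm.toAddMonoidHom.comp
    ((σ.comp P.relators.subtype).codRestrict (Int.castAddHom ℚ).range fun k => hK k.2)
  obtain ⟨ψ, hψ⟩ := exists_extension_of_subsingleton_ext P.relators hW φ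
  refine ⟨fun x => ψ (Finsupp.single (Sum.inl x) 1),
    fun d j => ψ (Finsupp.single (Sum.inr (d, j)) 1), fun d m => ?_⟩
  rw [relEval_map ψ, ← relator]
  rw [hψ ⟨_, P.relator_mem d m⟩]
  refine (AddEquiv.symm_apply_eq e).2 (Subtype.ext ?_)
  exact hσ d m

theorem isAlephOneCoseparable_of_exists_solution
    (h : ∀ c : D → ℕ → ℕ →₀ ℤ, ∃ (f : X → ℕ →₀ ℤ) (g : D → ℕ → ℕ →₀ ℤ),
      ∀ d m, relEval (fun i => f (P.ladder d i)) (g d) (P.rel d m) = c d m) :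
    IsAlephOneCoseparable P.Group := by
  refine subsingleton_ext_of_exists_extension P.relators fun φ => ?_
  obtain ⟨f, g, hfg⟩ := h fun d m => φ ⟨_, P.relator_mem d m⟩
  refine ⟨evalGens f g, fun ⟨k, hk⟩ => ?_⟩
  induction hk using AddSubgroup.closure_induction with
  | mem k hk =>
    obtain ⟨p, rfl⟩ := hk
    rw [evalGens_relator]
    exact hfg p.1 p.2
  | zero => rw [map_zero]; exact (map_zero φ).symm
  | add v w hv hw ihv ihw =>
    rw [map_add, ihv, ihw, ← map_add]
    rfl
  | neg v hv ihv =>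
    rw [map_neg, ihv, ← map_neg]
    rfl

end LadderPresentation

/-! ### The three systems of relations. -/

/-- The Chinese remainder theorem in an abelian group. -/
theorem exists_forall_zsmul_eq_sub {G κ : Type*} [AddCommGroup G] (s : Finset κ) (p : κ → ℕ)
    (hp : ∀ i ∈ s, ∀ j ∈ s, i ≠ j → Nat.Coprime (p i) (p j)) (a : κ → G) :
    ∃ y, ∀ i ∈ s, ∃ z, (p i : ℤ) • z = y - a i := by
  classical
  induction s using Finset.induction_on with
  | empty => exact ⟨0, by simp⟩
  | insert i s hi ih =>
    obtain ⟨y, hy⟩ := ih fun j hj k hk => hp j (Finset.mem_insert_of_mem hj) k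
      (Finset.mem_insert_of_mem hk)
    have hcop : Nat.Coprime (∏ j ∈ s, p j) (p i) := Nat.Coprime.prod_left fun j hj =>
      hp j (Finset.mem_insert_of_mem hj) i (Finset.mem_insert_self i s)
        (fun h => hi (h ▸ hj))
    obtain ⟨u, v, huv⟩ := Nat.isCoprime_iff_coprime.2 hcop
    refine ⟨y + (u * (∏ j ∈ s, p j : ℕ) : ℤ) • (a i - y), fun j hj => ?_⟩
    rcases Finset.mem_insert.1 hj with rfl | hj
    · refine ⟨v • (y - a j), ?_⟩
      have h1 : (u * (∏ j ∈ s, p j : ℕ) : ℤ) = 1 - v * p j := by linarith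
      rw [h1, smul_smul, sub_smul, one_smul, mul_comm (p j : ℤ) v, smul_sub, smul_sub]
      abel
    · obtain ⟨z, hz⟩ := hy j hj
      obtain ⟨t, ht⟩ := Finset.dvd_prod_of_mem p hj
      refine ⟨z + (u * t : ℤ) • (a i - y), ?_⟩
      rw [smul_add, hz, ht, smul_smul]
      push_cast
      rw [show (p j : ℤ) * (u * t) = u * (p j * t) by ring]
      abel

theorem RationallySolvable.of_recursion {R : ℕ → ℕ ⊕ ℕ →₀ ℤ} (p : ℕ → ℕ) (hp : ∀ k, p k ≠ 0)
    (h : ∀ (V : Type) [AddCommGroup V] (ξ : ℕ → V), ∃ Φ : ℕ → V → V → V, ∀ (ζ : ℕ → V) k,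
      relEval ξ ζ (R k) = Φ k (ζ 0) (ζ k) - (p k : ℤ) • ζ (k + 1)) : RationallySolvable R := by
  intro V _ _ ξ c
  obtain ⟨Φ, hΦ⟩ := h V ξ
  let ζ : ℕ → V := Nat.rec 0 fun k v => (p k : ℚ)⁻¹ • (Φ k 0 v - c k)
  refine ⟨ζ, fun k => ?_⟩
  have h1 : ζ (k + 1) = (p k : ℚ)⁻¹ • (Φ k (ζ 0) (ζ k) - c k) := rfl
  have hk : (p k : ℚ) ≠ 0 := Nat.cast_ne_zero.2 (hp k)
  rw [hΦ, h1, ← Int.cast_smul_eq_zsmul ℚ, smul_smul, Int.cast_natCast, mul_inv_cancel₀ hk,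
    one_smul, sub_sub_cancel]

/-- The relations `p k • z k = y - x k`. -/
noncomputable def divisionRel (p : ℕ → ℕ) (k : ℕ) : ℕ ⊕ ℕ →₀ ℤ :=
  Finsupp.single (Sum.inr 0) 1 - Finsupp.single (Sum.inl k) 1 -
    Finsupp.single (Sum.inr (k + 1)) (p k : ℤ)

theorem relEval_divisionRel {G : Type*} [AddCommGroup G] (p : ℕ → ℕ) (ξ ζ : ℕ → G) (k : ℕ) :
    relEval ξ ζ (divisionRel p k) = ζ 0 - ξ k - (p k : ℤ) • ζ (k + 1) := by
  simp [divisionRel]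

theorem rationallySolvable_divisionRel (p : ℕ → ℕ) (hp : ∀ k, p k ≠ 0) :
    RationallySolvable (divisionRel p) :=
  .of_recursion p hp fun _ _ ξ => ⟨fun k y _ => y - ξ k, fun ζ k => relEval_divisionRel p ξ ζ k⟩

/-- The Chinese remainder theorem gives a `y` suited to the `N` prescribed values; each later `ξ k`
is free and is chosen so that its quotient is zero. -/
theorem tailSolvable_divisionRel (p : ℕ → ℕ)
    (hcop : ∀ i j, i ≠ j → Nat.Coprime (p i) (p j)) : TailSolvable (divisionRel p) := by
  intro G _ N ξ₀ c
  obtain ⟨y, hy⟩ := exists_forall_zsmul_eq_sub (Finset.range N) p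
    (fun i _ j _ => hcop i j) (fun i => ξ₀ i + c i)
  let ξ : ℕ → G := fun i => if i < N then ξ₀ i else y - c i
  have hz : ∀ k, ∃ z, (p k : ℤ) • z = y - ξ k - c k := by
    intro k
    by_cases hk : k < N
    · obtain ⟨z, hz⟩ := hy k (Finset.mem_range.2 hk)
      exact ⟨z, by simp only [ξ, if_pos hk, hz]; abel⟩
    · exact ⟨0, by simp [ξ, if_neg hk]⟩
  choose z hz using hz
  refine ⟨ξ, fun k => Nat.casesOn k y z, fun i hi => if_pos hi, fun k => ?_⟩
  rw [relEval_divisionRel]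
  change y - ξ k - (p k : ℤ) • z k = c k
  rw [hz, sub_sub_cancel]

/-- The relations `p k • z k = y - (x m - x n)`, where `k` is the code of the pair `n < m`. -/
noncomputable def pairDivisionRel (p : ℕ → ℕ) (k : ℕ) : ℕ ⊕ ℕ →₀ ℤ :=
  Finsupp.single (Sum.inr 0) 1 -
    (Finsupp.single (Sum.inl (k.unpair.1 + k.unpair.2 + 1)) 1 -
      Finsupp.single (Sum.inl k.unpair.1) 1) -
    Finsupp.single (Sum.inr (k + 1)) (p k : ℤ)

theorem relEval_pairDivisionRel {G : Type*} [AddCommGroup G] (p : ℕ → ℕ) (ξ ζ : ℕ → G) (k : ℕ) :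
    relEval ξ ζ (pairDivisionRel p k) =
      ζ 0 - (ξ (k.unpair.1 + k.unpair.2 + 1) - ξ k.unpair.1) - (p k : ℤ) • ζ (k + 1) := by
  simp [pairDivisionRel]

theorem rationallySolvable_pairDivisionRel (p : ℕ → ℕ) (hp : ∀ k, p k ≠ 0) :
    RationallySolvable (pairDivisionRel p) :=
  .of_recursion p hp fun _ _ ξ =>
    ⟨fun k y _ => y - (ξ (k.unpair.1 + k.unpair.2 + 1) - ξ k.unpair.1),
      fun ζ k => relEval_pairDivisionRel p ξ ζ k⟩

/-- The prescribed values constrain `y` by finitely many congruences. With `y` fixed, each further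
`ξ m` has to satisfy one congruence for each `n < m`, to pairwise coprime moduli, so it is found by
recursion. -/
theorem tailSolvable_pairDivisionRel (p : ℕ → ℕ)
    (hcop : ∀ i j, i ≠ j → Nat.Coprime (p i) (p j)) : TailSolvable (pairDivisionRel p) := by
  intro G _ N ξ₀ c
  obtain ⟨y, hy⟩ := exists_forall_zsmul_eq_sub
    ((Finset.range N ×ˢ Finset.range N).image fun q => Nat.pair q.1 q.2) p
    (fun i _ j _ => hcop i j)
    (fun k => ξ₀ (k.unpair.1 + k.unpair.2 + 1) - ξ₀ k.unpair.1 + c k)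
  obtain ⟨ξ, hξ⟩ := exists_wellFounded_choice (β := G) (Nat.lt_wfRel.wf)
    (fun m prev b => (m < N → b = ξ₀ m) ∧ (N ≤ m → ∀ n (h : n < m), ∃ z,
      (p (Nat.pair n (m - n - 1)) : ℤ) • z =
        y - (b - prev n h) - c (Nat.pair n (m - n - 1)))) (by
    intro m prev
    by_cases hm : m < N
    · exact ⟨ξ₀ m, fun _ => rfl, fun h => absurd hm (not_lt.2 h)⟩
    · obtain ⟨b, hb⟩ := exists_forall_zsmul_eq_sub (Finset.univ : Finset (Fin m))
        (fun n => p (Nat.pair n (m - n - 1)))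
        (fun i _ j _ hij => hcop _ _ fun h => hij (Fin.ext (Nat.pair_eq_pair.1 h).1))
        (fun n => y + prev n n.2 - c (Nat.pair n (m - n - 1)))
      refine ⟨b, fun h => absurd h hm, fun _ n hn => ?_⟩
      obtain ⟨z, hz⟩ := hb ⟨n, hn⟩ (Finset.mem_univ _)
      refine ⟨-z, ?_⟩
      rw [smul_neg, hz]
      abel)
  have hz : ∀ k, ∃ z, (p k : ℤ) • z =
      y - (ξ (k.unpair.1 + k.unpair.2 + 1) - ξ k.unpair.1) - c k := by
    intro k
    by_cases hk : k.unpair.1 + k.unpair.2 + 1 < N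
    · obtain ⟨z, hz⟩ := hy k (Finset.mem_image.2 ⟨k.unpair, by simp; omega, Nat.pair_unpair k⟩)
      refine ⟨z, ?_⟩
      rw [hz, (hξ _).1 hk, (hξ _).1 (by omega)]
      abel
    · have := (hξ _).2 (not_lt.1 hk) k.unpair.1 (by omega)
      rwa [show k.unpair.1 + k.unpair.2 + 1 - k.unpair.1 - 1 = k.unpair.2 by omega,
        Nat.pair_unpair] at this
  choose z hz using hz
  refine ⟨ξ, fun k => Nat.casesOn k y z, fun i hi => (hξ i).1 hi, fun k => ?_⟩
  rw [relEval_pairDivisionRel]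
  change y - _ - (p k : ℤ) • z k = c k
  rw [hz, sub_sub_cancel]

/-- The relations `2 • y (k + 1) = y k - x k`. -/
noncomputable def halvingRel (k : ℕ) : ℕ ⊕ ℕ →₀ ℤ :=
  Finsupp.single (Sum.inr k) 1 - Finsupp.single (Sum.inl k) 1 -
    Finsupp.single (Sum.inr (k + 1)) 2

theorem relEval_halvingRel {G : Type*} [AddCommGroup G] (ξ ζ : ℕ → G) (k : ℕ) :
    relEval ξ ζ (halvingRel k) = ζ k - ξ k - (2 : ℤ) • ζ (k + 1) := by
  simp [halvingRel]

theorem rationallySolvable_halvingRel : RationallySolvable halvingRel :=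
  .of_recursion (fun _ => 2) (fun _ => two_ne_zero) fun _ _ ξ =>
    ⟨fun k _ v => v - ξ k, fun ζ k => relEval_halvingRel ξ ζ k⟩

/-- Take `ζ = 0` from `N` on and compute the earlier values backwards; no division by 2 occurs. -/
theorem exists_halving_solution {G : Type*} [AddCommGroup G] (N : ℕ) (ξ c : ℕ → G)
    (h : ∀ m, N ≤ m → ξ m = -c m) : ∃ ζ : ℕ → G, ∀ m, relEval ξ ζ (halvingRel m) = c m := by
  suffices ∃ ζ : ℕ → G, ∀ m, ζ m = ξ m + c m + (2 : ℤ) • ζ (m + 1) by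
    obtain ⟨ζ, hζ⟩ := this
    refine ⟨ζ, fun m => ?_⟩
    rw [relEval_halvingRel, hζ m]
    abel
  induction N generalizing ξ c with
  | zero => exact ⟨0, fun m => by simp [h m (Nat.zero_le m)]⟩
  | succ N ih =>
    obtain ⟨ζ, hζ⟩ := ih (fun m => ξ (m + 1)) (fun m => c (m + 1))
      fun m hm => h (m + 1) (Nat.succ_le_succ hm)
    refine ⟨fun m => Nat.casesOn m (ξ 0 + c 0 + (2 : ℤ) • ζ 0) ζ, fun m => ?_⟩
    cases m with
    | zero => rfl
    | succ m => exact hζ m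

theorem tailSolvable_halvingRel : TailSolvable halvingRel := by
  intro G _ N ξ₀ c
  let ξ : ℕ → G := fun i => if i < N then ξ₀ i else -c i
  obtain ⟨ζ, hζ⟩ := exists_halving_solution N ξ c fun m hm => if_neg (not_lt.2 hm)
  exact ⟨ξ, ζ, fun i hi => if_pos hi, hζ⟩

theorem le_natAbs_of_dvd_sub_half {p : ℕ} {y : ℤ} (h : (p : ℤ) ∣ y - (p / 2 : ℕ)) :
    p ≤ 2 * y.natAbs + 1 := by
  by_contra hlt
  have h1 : (p : ℤ) ∣ (p / 2 : ℕ) - y := by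
    rw [← neg_sub]
    exact (dvd_neg).2 h
  have h2 := Int.le_of_dvd (by omega) h1
  omega

/-- An integer is near a multiple of `p` if its distance to some multiple is less than about
`p / 4`. -/
def IsNearMultiple (p : ℕ) (z : ℤ) : Prop := ∃ t : ℤ, 4 * |t| + 4 < p ∧ (p : ℤ) ∣ z - t

/-- If `z` were also congruent to a small `t`, then `t - y + ⌊p/2⌋` would be a multiple of `p`
strictly between 0 and `p`. -/
theorem not_isNearMultiple_sub_half {p : ℕ} {y z : ℤ} (hy : 4 * |y| + 4 < p)
    (h : (p : ℤ) ∣ z - (y - (p / 2 : ℕ))) : ¬ IsNearMultiple p z := by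
  rintro ⟨t, ht, hdvd⟩
  have h1 : (p : ℤ) ∣ t - y + (p / 2 : ℕ) := by
    have := dvd_sub h hdvd
    rwa [show z - (y - ((p / 2 : ℕ) : ℤ)) - (z - t) = t - y + (p / 2 : ℕ) by ring] at this
  have h2 := abs_le.1 (le_refl |t|)
  have h3 := abs_le.1 (le_refl |y|)
  have h4 : 0 < t - y + ((p / 2 : ℕ) : ℤ) := by omega
  have h5 := Int.le_of_dvd h4 h1
  omega

/-! ### Countable ordinals and ladders. -/

namespace OmegaOne

theorem succ_lt_omega_one (α : OmegaOne) : Order.succ α.1 < Ordinal.omega 1 :=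
  (Cardinal.isSuccLimit_omega 1).succ_lt α.2

theorem exists_gt (α : OmegaOne) : ∃ β : OmegaOne, α < β :=
  ⟨⟨_, succ_lt_omega_one α⟩, Order.lt_succ α.1⟩

theorem exists_isLUB {ι : Type*} [Countable ι] (e : ι → OmegaOne) :
    ∃ δ : OmegaOne, IsLUB (Set.range e) δ := by
  have hb : BddAbove (Set.range fun n => (e n).1) := ⟨Ordinal.omega 1, by
    rintro _ ⟨n, rfl⟩
    exact (e n).2.le⟩
  refine ⟨⟨⨆ n, (e n).1, Ordinal.iSup_lt_omega_one fun n => (e n).2⟩, ?_, ?_⟩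
  · rintro _ ⟨n, rfl⟩
    exact le_ciSup hb n
  · intro β hβ
    exact Ordinal.iSup_le fun n => (hβ ⟨n, rfl⟩ : e n ≤ β)

theorem exists_forall_lt {C : Set OmegaOne} (hC : C.Countable) : ∃ β, ∀ x ∈ C, x < β := by
  have := hC.to_subtype
  obtain ⟨δ, hδ⟩ := exists_isLUB (fun x : C => x.1)
  obtain ⟨β, hβ⟩ := exists_gt δ
  exact ⟨β, fun x hx => (hδ.1 ⟨⟨x, hx⟩, rfl⟩).trans_lt hβ⟩

theorem countable_Iio (β : OmegaOne) : (Set.Iio β).Countable := by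
  have h1 : (Set.Iio β.1).Countable := by
    rw [← Cardinal.le_aleph0_iff_set_countable, Cardinal.mk_Iio_ordinal, Cardinal.lift_le_aleph0,
      ← Order.lt_succ_iff, Cardinal.succ_aleph0, ← Cardinal.lt_ord, Cardinal.ord_aleph]
    exact β.2
  exact (h1.preimage Subtype.val_injective).mono fun x hx => hx

theorem countable_Iic (β : OmegaOne) : (Set.Iic β).Countable := by
  obtain ⟨γ, hγ⟩ := exists_gt β
  exact (countable_Iio γ).mono fun x hx => lt_of_le_of_lt hx hγ

theorem mk_shrink : Cardinal.mk (Shrink.{0} OmegaOne) = Cardinal.aleph 1 := by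
  have h := Cardinal.mk_Iio_ordinal (Ordinal.omega.{0} 1)
  have h' := Cardinal.lift_mk_eq'.2 ⟨equivShrink.{0} OmegaOne⟩
  rw [Cardinal.lift_uzero] at h'
  rw [Ordinal.card_omega] at h
  exact Cardinal.lift_injective (h'.symm.trans h)

theorem exists_isLUB_mem_lim {e : ℕ → OmegaOne} (he : StrictMono e) :
    ∃ δ ∈ limOmegaOne, IsLUB (Set.range e) δ := by
  obtain ⟨δ, hδ⟩ := exists_isLUB e
  have hlt : ∀ n, e n < δ := fun n => (he n.lt_succ_self).trans_le (hδ.1 ⟨n + 1, rfl⟩)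
  refine ⟨δ, ⟨?_, ?_⟩, hδ⟩
  · intro h
    exact (h.isBot (e 0).1).not_gt (hlt 0)
  · intro b hb
    have hbδ : (⟨b, hb.1.trans δ.2⟩ : OmegaOne) < δ := hb.1
    obtain ⟨_, ⟨n, rfl⟩, hn⟩ := (lt_isLUB_iff hδ).1 hbδ
    exact hb.2 hn (hlt n)

theorem isStationary_lim : IsStationary limOmegaOne := by
  intro t ht
  have hstep : ∀ α : OmegaOne, ∃ β ∈ t, α < β := fun α => by
    obtain ⟨γ, hγ⟩ := exists_gt α
    obtain ⟨β, hβ, h⟩ := ht.isCofinal γ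
    exact ⟨β, hβ, hγ.trans_le h⟩
  choose s hst hs using hstep
  have h0 : (0 : Ordinal) < Ordinal.omega 1 := Ordinal.omega_pos 1
  let e : ℕ → OmegaOne := fun n => s (s^[n] ⟨0, h0⟩)
  have he : StrictMono e := strictMono_nat_of_lt_succ fun n => by
    simp only [e, Function.iterate_succ_apply']
    exact hs _
  obtain ⟨δ, hδ, hlub⟩ := exists_isLUB_mem_lim he
  exact ⟨δ, hδ, ht.isLUB_mem (by rintro _ ⟨n, rfl⟩; exact hst _) (Set.range_nonempty e) hlub⟩

theorem succ_lt_of_mem_lim {δ : OmegaOne} (hδ : δ ∈ limOmegaOne) {α : OmegaOne} (h : α < δ) :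
    (⟨_, succ_lt_omega_one α⟩ : OmegaOne) < δ :=
  hδ.succ_lt h

theorem exists_isLadder {δ : OmegaOne} (hδ : δ ∈ limOmegaOne) : ∃ e, IsLadder δ e := by
  have hne : (Set.Iio δ).Nonempty := by
    refine ⟨⟨0, Ordinal.omega_pos 1⟩, ?_⟩
    exact hδ.bot_lt
  obtain ⟨a, ha⟩ := (countable_Iio δ).exists_eq_range hne
  have haδ : ∀ n, a n < δ := fun n => by
    have : a n ∈ Set.Iio δ := ha ▸ ⟨n, rfl⟩
    exact this
  let e : ℕ → OmegaOne := Nat.rec (a 0) fun n v => ⟨_, succ_lt_omega_one (max v (a n))⟩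
  have hmax : ∀ n, max (e n) (a n) < e (n + 1) := fun n => Order.lt_succ (max (e n) (a n)).1
  refine ⟨e, strictMono_nat_of_lt_succ fun n => (le_max_left _ _).trans_lt (hmax n), ?_, ?_⟩
  · intro n
    induction n with
    | zero => exact haδ 0
    | succ n ih => exact succ_lt_of_mem_lim hδ (max_lt ih (haδ n))
  · intro α hα
    obtain ⟨n, rfl⟩ : α ∈ Set.range a := ha ▸ hα
    exact ⟨n + 1, ((le_max_right _ _).trans_lt (hmax n)).le⟩

end OmegaOne

theorem IsLadder.finite_lt {δ β : OmegaOne} {e : ℕ → OmegaOne} (he : IsLadder δ e) (hβ : β < δ) :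
    {m | e m < β}.Finite := by
  obtain ⟨n, hn⟩ := he.cofinal β hβ
  exact (Set.finite_Iio n).subset fun m hm => he.strictMono.lt_iff_lt.1 (lt_of_lt_of_le hm hn)

theorem IsLadder.finite_mem_range {δ δ' : OmegaOne} {e e' : ℕ → OmegaOne} (he : IsLadder δ e)
    (he' : IsLadder δ' e') (h : δ ≠ δ') : {m | e m ∈ Set.range e'}.Finite := by
  rcases lt_or_gt_of_ne h with h | h
  · have : (e' '' {m | e' m < δ}).Finite := (he'.finite_lt h).image e'
    refine (this.preimage he.strictMono.injective.injOn).subset ?_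
    rintro m ⟨n, hn⟩
    exact ⟨n, lt_of_eq_of_lt hn (he.lt m), hn⟩
  · refine (he.finite_lt h).subset ?_
    rintro m ⟨n, hn⟩
    exact lt_of_eq_of_lt hn.symm (he'.lt n)

/-! ### From Whitehead groups to 2-uniformization. -/

/-- The presentation with generators indexed by `ω₁` attached to a ladder system. -/
noncomputable def ladderSystemPresentation {S : Set OmegaOne} (η : S → ℕ → OmegaOne)
    (R : S → ℕ → ℕ ⊕ ℕ →₀ ℤ) : LadderPresentation (Shrink.{0} OmegaOne) (Shrink.{0} S) where
  ladder d m := equivShrink OmegaOne (η ((equivShrink S).symm d) m)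
  rel d := R ((equivShrink S).symm d)

theorem IsLadderSystem.isTame {S : Set OmegaOne} {η : S → ℕ → OmegaOne} (hη : IsLadderSystem S η)
    {R : S → ℕ → ℕ ⊕ ℕ →₀ ℤ} (hT : ∀ δ, TailSolvable (R δ)) (hQ : ∀ δ, RationallySolvable (R δ)) :
    (ladderSystemPresentation η R).IsTame where
  injective d := (equivShrink OmegaOne).injective.comp (hη _).strictMono.injective
  almostDisjoint d d' hd := by
    have hne : ((equivShrink S).symm d).1 ≠ ((equivShrink S).symm d').1 := fun h =>
      hd ((equivShrink S).symm.injective (Subtype.ext h))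
    refine ((hη _).finite_mem_range (hη _) hne).subset ?_
    rintro m ⟨n, hn⟩
    exact ⟨n, (equivShrink OmegaOne).injective hn⟩
  exists_closed X₀ D₀ hX₀ hD₀ := by
    obtain ⟨β, hβ⟩ := OmegaOne.exists_forall_lt ((hX₀.image (equivShrink OmegaOne).symm).union
      (hD₀.image fun d => ((equivShrink S).symm d).1))
    -- Cutting at `β` gives a closed pair: ladders on `δ ≤ β` stay below `β`, and ladders on `δ > β`
    -- have finitely many points below `β`.
    refine ⟨{x | (equivShrink OmegaOne).symm x < β}, {d | ((equivShrink S).symm d).1 ≤ β},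
      (OmegaOne.countable_Iio β).preimage (equivShrink OmegaOne).symm.injective,
      (OmegaOne.countable_Iic β).preimage
        (Subtype.val_injective.comp (equivShrink S).symm.injective), ?_, ?_, ?_, ?_⟩
    · intro x hx
      exact hβ _ (Or.inl ⟨x, hx, rfl⟩)
    · intro d hd
      exact (hβ _ (Or.inr ⟨d, hd, rfl⟩)).le
    · intro d hd m
      simp only [ladderSystemPresentation, Set.mem_ofPred_eq, Equiv.symm_apply_apply]
      exact ((hη _).lt m).trans_le hd
    · intro d hd
      simp only [ladderSystemPresentation, Set.mem_ofPred_eq, Equiv.symm_apply_apply]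
      exact (hη _).finite_lt (not_le.1 hd)
  tailSolvable d := hT _
  rationallySolvable d := hQ _

theorem mk_ladderSystemPresentation_group {S : Set OmegaOne} {η : S → ℕ → OmegaOne}
    {R : S → ℕ → ℕ ⊕ ℕ →₀ ℤ} (h : (ladderSystemPresentation η R).IsTame) :
    Cardinal.mk (ladderSystemPresentation η R).Group = Cardinal.aleph 1 := by
  refine h.mk_group OmegaOne.mk_shrink ?_
  rw [← OmegaOne.mk_shrink]
  exact Cardinal.mk_le_of_injective (f := fun d => equivShrink OmegaOne ((equivShrink S).symm d).1)
    ((equivShrink OmegaOne).injective.comp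
      (Subtype.val_injective.comp (equivShrink S).symm.injective))

/-- If all strongly `ℵ₁`-free groups of cardinality `ℵ₁` are Whitehead groups, then the systems of
equations attached to a ladder system are solvable in the integers. -/
theorem AllWhitehead.exists_solution (h : AllWhitehead) {S : Set OmegaOne} {η : S → ℕ → OmegaOne}
    (hη : IsLadderSystem S η) {R : S → ℕ → ℕ ⊕ ℕ →₀ ℤ} (hT : ∀ δ, TailSolvable (R δ))
    (hQ : ∀ δ, RationallySolvable (R δ)) (c : S → ℕ → ℤ) :
    ∃ (f : OmegaOne → ℤ) (g : S → ℕ → ℤ),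
      ∀ δ m, relEval (fun i => f (η δ i)) (g δ) (R δ m) = c δ m := by
  have hP := hη.isTame hT hQ
  obtain ⟨f, g, hfg⟩ := hP.exists_solution_of_isWhitehead
    (h _ (mk_ladderSystemPresentation_group hP) hP.isStronglyAlephOneFree)
    (fun d => c ((equivShrink S).symm d))
  refine ⟨fun α => f (equivShrink OmegaOne α), fun δ => g (equivShrink S δ), fun δ m => ?_⟩
  have := hfg (equivShrink S δ) m
  simpa [ladderSystemPresentation] using this

theorem IsLadder.tail {δ : OmegaOne} {e : ℕ → OmegaOne} (he : IsLadder δ e) (N : ℕ) :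
    IsLadder δ (fun n => e (n + N)) where
  strictMono := fun a b h => he.strictMono (Nat.add_lt_add_right h N)
  lt n := he.lt _
  cofinal α hα := by
    obtain ⟨n, hn⟩ := he.cofinal α hα
    exact ⟨n, hn.trans (he.strictMono.monotone (Nat.le_add_right n N))⟩

theorem coprime_nth_prime {i j : ℕ} (h : i ≠ j) :
    Nat.Coprime (Nat.nth Nat.Prime i) (Nat.nth Nat.Prime j) :=
  (Nat.coprime_primes (Nat.prime_nth_prime i) (Nat.prime_nth_prime j)).2 fun h' =>
    h (Nat.nth_injective Nat.infinite_setOfPred_prime h')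

/-- If `f` agrees at the `n`-th and `m`-th points of a ladder, then `y ≡ ⌊p/2⌋` modulo the prime of
that pair, which bounds this prime by `2|y| + 1`. The prime exceeds `n + 1`, so there is no
coincidence beyond `2|y|`. -/
theorem AllWhitehead.exists_injOn_tails (h : AllWhitehead) {S : Set OmegaOne}
    {η : S → ℕ → OmegaOne} (hη : IsLadderSystem S η) :
    ∃ (e : OmegaOne → ℕ) (N : S → ℕ), ∀ δ, Function.Injective fun n => e (η δ (n + N δ)) := by
  let p : ℕ → ℕ := Nat.nth Nat.Prime
  have hp : ∀ k, k + 2 ≤ p k := Nat.add_two_le_nth_prime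
  obtain ⟨f, g, hfg⟩ := h.exists_solution hη
    (R := fun _ => pairDivisionRel p)
    (fun _ => tailSolvable_pairDivisionRel p fun _ _ => coprime_nth_prime)
    (fun _ => rationallySolvable_pairDivisionRel p fun k => by have := hp k; omega)
    (fun _ k => ((p k / 2 : ℕ) : ℤ))
  refine ⟨fun α => Equiv.intEquivNat (f α), fun δ => 2 * (g δ 0).natAbs, fun δ => ?_⟩
  suffices H : ∀ n m, n < m → 2 * (g δ 0).natAbs ≤ n → f (η δ n) ≠ f (η δ m) by
    intro a b hab
    by_contra hne
    dsimp only at hab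
    have hab' := Equiv.intEquivNat.injective hab
    rcases lt_or_gt_of_ne hne with hlt | hlt
    · exact H _ _ (Nat.add_lt_add_right hlt _) (Nat.le_add_left _ _) hab'
    · exact H _ _ (Nat.add_lt_add_right hlt _) (Nat.le_add_left _ _) hab'.symm
  intro n m hnm hn heq
  have h1 := hfg δ (Nat.pair n (m - n - 1))
  rw [relEval_pairDivisionRel, Nat.unpair_pair, show n + (m - n - 1) + 1 = m by omega, heq] at h1
  have h2 := le_natAbs_of_dvd_sub_half (p := p (Nat.pair n (m - n - 1))) (y := g δ 0)
    ⟨g δ (Nat.pair n (m - n - 1) + 1), by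
      rw [smul_eq_mul] at h1
      linarith⟩
  have h3 := hp (Nat.pair n (m - n - 1))
  have h4 := Nat.left_le_pair n (m - n - 1)
  omega

/-- The prime `p α` depends on the ordinal and not on the ladder through it, so the colour can be
decoded from `α` alone. On a tail of a ladder these primes are distinct, hence coprime and
eventually large compared with `y`. -/
theorem AllWhitehead.allLadderSystemsUniformize_two (h : AllWhitehead) :
    AllLadderSystemsUniformize (Fin 2) := by
  classical
  intro S _ _ η hη c
  obtain ⟨e, N, he⟩ := h.exists_injOn_tails hη
  let p : OmegaOne → ℕ := fun α => Nat.nth Nat.Prime (e α)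
  let q : S → ℕ → ℕ := fun δ k => p (η δ (k + N δ))
  have hq : ∀ δ k, 2 ≤ q δ k := fun δ k => (Nat.prime_nth_prime _).two_le
  obtain ⟨f, g, hfg⟩ := h.exists_solution (η := fun δ k => η δ (k + N δ))
    (fun δ => (hη δ).tail (N δ)) (R := fun δ => divisionRel (q δ))
    (fun δ => tailSolvable_divisionRel _ fun i j hij => coprime_nth_prime fun h' => hij (he δ h'))
    (fun δ => rationallySolvable_divisionRel _ fun k => by have := hq δ k; omega)
    (fun δ k => if c δ (k + N δ) = 0 then 0 else ((q δ k / 2 : ℕ) : ℤ))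
  have hbig : ∀ δ, ∃ M, ∀ k, M ≤ k → 4 * |g δ 0| + 4 < q δ k := by
    intro δ
    have hfin : {k | e (η δ (k + N δ)) ≤ 4 * (g δ 0).natAbs + 4}.Finite :=
      (Set.finite_Iic (4 * (g δ 0).natAbs + 4)).preimage (he δ).injOn
    obtain ⟨M, hM⟩ := hfin.bddAbove
    refine ⟨M + 1, fun k hk => ?_⟩
    have h1 : ¬ e (η δ (k + N δ)) ≤ 4 * (g δ 0).natAbs + 4 := fun h' => by
      have := hM h'
      omega
    have h2 : e (η δ (k + N δ)) + 2 ≤ q δ k := Nat.add_two_le_nth_prime _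
    have h3 := Int.abs_eq_natAbs (g δ 0)
    omega
  choose M hM using hbig
  refine ⟨fun α => if IsNearMultiple (p α) (f α) then 0 else 1, fun δ => M δ + N δ,
    fun δ n hn => ?_⟩
  dsimp only at hn ⊢
  obtain ⟨k, rfl⟩ : ∃ k, n = k + N δ := ⟨n - N δ, by omega⟩
  have hk := hM δ k (by omega)
  have h1 := hfg δ k
  rw [relEval_divisionRel, smul_eq_mul] at h1
  by_cases hc : c δ (k + N δ) = 0
  · rw [if_pos hc] at h1
    rw [if_pos, hc]
    exact ⟨g δ 0, hk, -g δ (k + 1), by linarith⟩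
  · rw [if_neg hc] at h1
    rw [if_neg, Fin.eq_one_of_ne_zero _ hc]
    exact not_isNearMultiple_sub_half hk ⟨-g δ (k + 1), by linarith⟩

/-! ### 2-uniformization and ω-uniformization. -/

namespace OmegaOne

/-- The greatest limit ordinal (or zero) below an ordinal. -/
noncomputable def base (α : OmegaOne) : Ordinal := Ordinal.omega0 * (α.1 / Ordinal.omega0)

theorem exists_index (α : OmegaOne) : ∃ n : ℕ, α.1 % Ordinal.omega0 = n :=
  Ordinal.lt_omega0.1 (Ordinal.mod_lt _ Ordinal.omega0_ne_zero)

/-- The finite distance of an ordinal to `base`. -/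
noncomputable def index (α : OmegaOne) : ℕ := (exists_index α).choose

theorem base_add_index (α : OmegaOne) : base α + index α = α.1 := by
  rw [base, index, ← (exists_index α).choose_spec, Ordinal.div_add_mod]

theorem base_add_lt {α : OmegaOne} {δ : Ordinal} (hδ : Order.IsSuccLimit δ) (h : α.1 < δ)
    (n : ℕ) : base α + n < δ := by
  have hb : base α < δ := (Ordinal.mul_div_le _ _).trans_lt h
  induction n with
  | zero => simpa using hb
  | succ n ih =>
    rw [Nat.cast_succ, ← add_assoc]
    exact hδ.add_one_lt ih

/-- An injection of `ω₁ × ω` into `ω₁` that moves ordinals up by finite amounts. -/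
noncomputable def spread (α : OmegaOne) (k : ℕ) : OmegaOne :=
  ⟨base α + (Nat.pair (index α) k : ℕ), base_add_lt (Cardinal.isSuccLimit_omega 1) α.2 _⟩

theorem spread_lt {α δ : OmegaOne} (hδ : δ ∈ limOmegaOne) (h : α < δ) (k : ℕ) : spread α k < δ :=
  base_add_lt hδ h _

theorem le_spread (α : OmegaOne) (k : ℕ) : α ≤ spread α k := by
  change α.1 ≤ base α + (Nat.pair (index α) k : ℕ)
  conv_lhs => rw [← base_add_index α]
  gcongr
  exact Nat.left_le_pair _ _

theorem spread_injective {α β : OmegaOne} {k l : ℕ} (h : spread α k = spread β l) :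
    α = β ∧ k = l := by
  have h1 : base α + (Nat.pair (index α) k : ℕ) = base β + (Nat.pair (index β) l : ℕ) :=
    congrArg Subtype.val h
  have hdiv : α.1 / Ordinal.omega0 = β.1 / Ordinal.omega0 := by
    have := congrArg (· / Ordinal.omega0) h1
    simpa [base, Ordinal.mul_add_div _ Ordinal.omega0_ne_zero, Ordinal.div_eq_zero_of_lt,
      Ordinal.natCast_lt_omega0] using this
  have hb : base α = base β := by rw [base, base, hdiv]
  rw [hb] at h1
  have h2 := Nat.pair_eq_pair.1 (Nat.cast_injective (add_left_cancel h1))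
  refine ⟨Subtype.ext ?_, h2.2⟩
  rw [← base_add_index α, ← base_add_index β, hb, h2.1]

end OmegaOne

/-- A set of order type `ω` that is cofinal in `δ` is the range of a ladder. -/
theorem exists_isLadder_range_eq {δ : OmegaOne} {Z : Set OmegaOne} (hZ : Z.Infinite)
    (hlt : ∀ z ∈ Z, z < δ) (hfin : ∀ β < δ, (Z ∩ Set.Iio β).Finite) :
    ∃ e, IsLadder δ e ∧ Set.range e = Z := by
  classical
  have : Infinite Z := hZ.to_subtype
  -- Counting predecessors embeds `Z` in ℕ, so the infinite set `Z` has order type ω.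
  let r : Z → ℕ := fun z => (Z ∩ Set.Iio z.1).ncard
  have hr : StrictMono r := fun a b hab => by
    refine Set.ncard_lt_ncard ⟨?_, ?_⟩ (hfin b (hlt b b.2))
    · exact fun x hx => ⟨hx.1, lt_trans (Set.mem_Iio.1 hx.2) hab⟩
    · exact fun h => lt_irrefl a.1 (h ⟨a.2, hab⟩).2
  have : Infinite (Set.range r) := (Set.infinite_range_of_injective hr.injective).to_subtype
  let i : ℕ ≃o Z := (Nat.Subtype.orderIsoOfNat (Set.range r)).trans (hr.orderIso r).symm
  refine ⟨fun n => (i n).1, ⟨fun a b h => i.strictMono h, fun n => hlt _ (i n).2, ?_⟩, ?_⟩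
  · intro α hα
    obtain ⟨z, hz, hz'⟩ := hZ.exists_notMem_finite (hfin α hα)
    refine ⟨i.symm ⟨z, hz⟩, ?_⟩
    rw [i.apply_symm_apply]
    exact not_lt.1 fun h => hz' ⟨hz, h⟩
  · ext z
    constructor
    · rintro ⟨n, rfl⟩
      exact (i n).2
    · intro hz
      exact ⟨i.symm ⟨z, hz⟩, by simp⟩

theorem AllLadderSystemsUniformize.two_of_nat (h : AllLadderSystemsUniformize ℕ) :
    AllLadderSystemsUniformize (Fin 2) := by
  intro S hS hst η hη c
  obtain ⟨f, fs, hf⟩ := h S hS hst η hη fun δ n => (c δ n : ℕ)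
  refine ⟨fun α => Fin.ofNat 2 (f α), fs, fun δ n hn => ?_⟩
  simp [hf δ n hn]

/-- Unary coding: the point `η δ n` is replaced by its copies with index `k ≤ c δ n`, of which only
the last gets colour 1. `OmegaOne.spread` keeps copies of different points apart and below `δ`, so
the copies form a ladder again. -/
theorem AllLadderSystemsUniformize.nat_of_two (h : AllLadderSystemsUniformize (Fin 2)) :
    AllLadderSystemsUniformize ℕ := by
  classical
  intro S hS hst η hη c
  let Z : S → Set OmegaOne := fun δ => {z | ∃ n k, k ≤ c δ n ∧ OmegaOne.spread (η δ n) k = z}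
  have hZ : ∀ δ : S, ∃ e, IsLadder δ.1 e ∧ Set.range e = Z δ := by
    intro δ
    refine exists_isLadder_range_eq ?_ ?_ ?_
    · refine Set.infinite_of_injective_forall_mem
        (f := fun n => OmegaOne.spread (η δ n) 0) (fun a b hab => ?_)
        fun n => ⟨n, 0, Nat.zero_le _, rfl⟩
      exact (hη δ).strictMono.injective (OmegaOne.spread_injective hab).1
    · rintro _ ⟨n, k, -, rfl⟩
      exact OmegaOne.spread_lt (hS δ.2) ((hη δ).lt n) k
    · intro β hβ
      refine (((hη δ).finite_lt hβ).biUnion fun n _ =>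
        (Set.finite_Iic (c δ n)).image fun k => OmegaOne.spread (η δ n) k).subset ?_
      rintro _ ⟨⟨n, k, hk, rfl⟩, hlt⟩
      exact Set.mem_biUnion (x := n) ((OmegaOne.le_spread _ k).trans_lt hlt) ⟨k, hk, rfl⟩
  choose e he heZ using hZ
  obtain ⟨f, fs, hf⟩ := h S hS hst e he fun δ i =>
    if ∃ n, e δ i = OmegaOne.spread (η δ n) (c δ n) then 1 else 0
  have hbound : ∀ δ, ∃ N, ∀ n, N ≤ n → ∀ k ≤ c δ n, ∀ i,
      e δ i = OmegaOne.spread (η δ n) k → fs δ ≤ i := by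
    intro δ
    have hfin : {n | ∃ i < fs δ, ∃ k, e δ i = OmegaOne.spread (η δ n) k}.Finite := by
      refine ((Set.finite_Iio (fs δ)).biUnion (t := fun i =>
        {n | ∃ k, e δ i = OmegaOne.spread (η δ n) k}) fun i _ => ?_).subset ?_
      · refine Set.Subsingleton.finite ?_
        rintro n ⟨k, hk⟩ n' ⟨k', hk'⟩
        exact (hη δ).strictMono.injective (OmegaOne.spread_injective (hk.symm.trans hk')).1
      · rintro n ⟨i, hi, hk⟩
        exact Set.mem_biUnion (x := i) hi hk
    obtain ⟨N, hN⟩ := hfin.bddAbove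
    refine ⟨N + 1, fun n hn k _ i hi => ?_⟩
    by_contra hlt
    have := hN ⟨i, not_le.1 hlt, k, hi⟩
    omega
  choose N hN using hbound
  -- Nothing is known of `f` at copies beyond `c δ n`, so the colour is recovered as the least index
  -- with value 1.
  refine ⟨fun α => sInf {k | f (OmegaOne.spread α k) = 1}, N, fun δ n hn => ?_⟩
  have hcol : ∀ k ≤ c δ n, (f (OmegaOne.spread (η δ n) k) = 1 ↔ k = c δ n) := by
    intro k hk
    obtain ⟨i, hi⟩ : OmegaOne.spread (η δ n) k ∈ Set.range (e δ) := heZ δ ▸ ⟨n, k, hk, rfl⟩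
    rw [← hi, hf δ i (hN δ n hn k hk i hi)]
    dsimp only
    rw [hi]
    constructor
    · intro h1
      by_contra hne
      rw [if_neg] at h1
      · exact zero_ne_one h1
      · rintro ⟨n', hn'⟩
        obtain ⟨h2, rfl⟩ := OmegaOne.spread_injective hn'
        exact hne (congrArg (c δ) ((hη δ).strictMono.injective h2).symm)
    · rintro rfl
      exact if_pos ⟨n, rfl⟩
  refine IsLeast.csInf_eq ⟨(hcol _ le_rfl).2 rfl, fun k hk => ?_⟩
  by_contra hlt
  have h1 := (hcol k (not_le.1 hlt).le).1 hk
  omega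

/-! ### A nonfree coseparable group. -/

section Halving

variable {S : Set OmegaOne} (η : S → ℕ → OmegaOne)

/-- The group with generators `x α` (`α < ω₁`) and `y δ n` (`δ ∈ S`), and relations
`2 • y δ (n + 1) = y δ n - x (η δ n)`. -/
abbrev HalvingGroup : Type := (ladderSystemPresentation η fun _ => halvingRel).Group

/-- The generator `x α`. -/
noncomputable def HalvingGroup.x (α : OmegaOne) : HalvingGroup η :=
  QuotientAddGroup.mk (Finsupp.single (Sum.inl (equivShrink OmegaOne α)) 1)

/-- The generator `y δ n`. -/
noncomputable def HalvingGroup.y (δ : S) (n : ℕ) : HalvingGroup η :=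
  QuotientAddGroup.mk (Finsupp.single (Sum.inr (equivShrink S δ, n)) 1)

theorem HalvingGroup.y_eq (δ : S) (n : ℕ) :
    HalvingGroup.y η δ n = HalvingGroup.x η (η δ n) + (2 : ℤ) • HalvingGroup.y η δ (n + 1) := by
  have h := (QuotientAddGroup.eq_zero_iff _).2
    ((ladderSystemPresentation η fun _ => halvingRel).relator_mem (equivShrink S δ) n)
  rw [LadderPresentation.relator, ← QuotientAddGroup.mk'_apply, ← relEval_map] at h
  change relEval _ _ (halvingRel n) = 0 at h
  rw [relEval_halvingRel, sub_sub, sub_eq_zero] at h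
  simp only [ladderSystemPresentation, Equiv.symm_apply_apply] at h
  exact h

/-- Sending every `x α` to 0 and `y δ j` to 2⁻ʲ times the basis vector of `δ` respects the relations
and separates the `y δ 0`. -/
theorem HalvingGroup.y_zero_injective :
    Function.Injective fun δ => HalvingGroup.y η δ 0 := by
  classical
  let P := ladderSystemPresentation η fun _ => halvingRel
  let D := Shrink.{0} S
  let σ := LadderPresentation.evalGens (X := Shrink.{0} OmegaOne) (D := D)
    (fun _ => (0 : D →₀ ℚ)) fun d j => Finsupp.single d ((2 : ℚ)⁻¹ ^ j)
  have hσ : P.relators ≤ σ.ker := P.relators_le_ker σ fun d m => by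
    rw [LadderPresentation.evalGens_relator]
    change relEval _ _ (halvingRel m) = 0
    rw [relEval_halvingRel, Finsupp.smul_single, sub_zero, sub_eq_zero, zsmul_eq_mul, pow_succ]
    congr 1
    push_cast
    ring
  intro δ δ' h
  have h1 : σ (Finsupp.single (Sum.inr (equivShrink S δ, 0)) 1) =
      σ (Finsupp.single (Sum.inr (equivShrink S δ', 0)) 1) :=
    congrArg (QuotientAddGroup.lift P.relators σ hσ) h
  simp only [σ, LadderPresentation.evalGens_single_inr, one_smul, pow_zero] at h1
  exact (equivShrink S).injective (Finsupp.single_left_injective one_ne_zero h1)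

/-- In a coordinate where the ladder generators vanish, the relations make `y δ 0` divisible by
every power of 2. -/
theorem HalvingGroup.y_zero_apply_eq_zero {I : Type*} (φ : HalvingGroup η →+ (I →₀ ℤ)) (δ : S) (i : I)
    (h : ∀ n, φ (HalvingGroup.x η (η δ n)) i = 0) : φ (HalvingGroup.y η δ 0) i = 0 := by
  have hpow : ∀ n, φ (HalvingGroup.y η δ 0) i = 2 ^ n * φ (HalvingGroup.y η δ n) i := by
    intro n
    induction n with
    | zero => simp
    | succ n ih =>
      rw [ih, HalvingGroup.y_eq η δ n, map_add, map_zsmul, Finsupp.add_apply, h n,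
        Finsupp.smul_apply, smul_eq_mul]
      ring
  have h1 : ∀ n, 2 ^ n ∣ (φ (HalvingGroup.y η δ 0) i).natAbs := fun n => by
    rw [← Int.natCast_dvd]
    exact ⟨_, by push_cast; exact hpow n⟩
  by_contra hne
  have h2 := Nat.le_of_dvd (Int.natAbs_pos.2 hne) (h1 (φ (HalvingGroup.y η δ 0) i).natAbs)
  exact absurd Nat.lt_two_pow_self (not_lt.2 h2)

end Halving

/-- Given a basis, the finite support of `y δ 0` is covered by supports of `x α` with `α` below some
ladder point `η δ n < δ`. But for each γ only countably many `y δ 0` are supported on the countable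
set `J γ`. A limit `δ` closed under the resulting bound `ψ` is a contradiction. -/
theorem HalvingGroup.not_free {η : limOmegaOne → ℕ → OmegaOne}
    (hη : IsLadderSystem limOmegaOne η) : ¬ Module.Free ℤ (HalvingGroup η) := by
  classical
  intro hfree
  let I := Module.Free.ChooseBasisIndex ℤ (HalvingGroup η)
  let ρ : HalvingGroup η →+ (I →₀ ℤ) := (Module.Free.chooseBasis ℤ _).repr.toLinearMap.toAddMonoidHom
  have hρ : Function.Injective ρ := (Module.Free.chooseBasis ℤ (HalvingGroup η)).repr.injective
  let J : OmegaOne → Set I := fun γ => ⋃ α ∈ Set.Iio γ, ((ρ (x η α)).support : Set I)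
  have hJ : ∀ γ, (J γ).Countable := fun γ =>
    (OmegaOne.countable_Iio γ).biUnion fun α _ => (Finset.countable_toSet _)
  have hJmono : Monotone J := fun γ γ' h => Set.biUnion_subset_biUnion_left fun α hα =>
    lt_of_lt_of_le hα h
  have hsub : ∀ δ, ∃ n, ((ρ (y η δ 0)).support : Set I) ⊆ J (η δ n) := by
    intro δ
    have h1 : ∀ i ∈ (ρ (y η δ 0)).support, ∃ n, ρ (x η (η δ n)) i ≠ 0 := by
      intro i hi
      by_contra! h
      exact Finsupp.mem_support_iff.1 hi (y_zero_apply_eq_zero η ρ δ i h)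
    choose! n hn using h1
    refine ⟨(ρ (y η δ 0)).support.sup n + 1, fun i hi => ?_⟩
    refine Set.mem_biUnion (x := η δ (n i)) ?_ (Finsupp.mem_support_iff.2 (hn i hi))
    exact (hη δ).strictMono (Nat.lt_succ_of_le (Finset.le_sup hi))
  have hcount : ∀ γ, {δ : limOmegaOne | ((ρ (y η δ 0)).support : Set I) ⊆ J γ}.Countable := by
    intro γ
    have := (hJ γ).to_subtype
    have hinj : Set.InjOn (fun δ => Finsupp.subtypeDomain (· ∈ J γ) (ρ (y η δ 0)))
        {δ : limOmegaOne | ((ρ (y η δ 0)).support : Set I) ⊆ J γ} := by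
      intro δ hδ δ' hδ' h
      refine y_zero_injective η (hρ (Finsupp.ext fun i => ?_))
      by_cases hi : i ∈ J γ
      · exact DFunLike.congr_fun h ⟨i, hi⟩
      · rw [Finsupp.notMem_support_iff.1 fun h' => hi (hδ h'),
          Finsupp.notMem_support_iff.1 fun h' => hi (hδ' h')]
    have : Countable (Subtype (· ∈ J γ)) := this
    exact Set.MapsTo.countable_of_injOn (Set.mapsTo_univ _ _) hinj Set.countable_univ
  have hψ : ∀ γ, ∃ β, γ < β ∧
      ∀ δ : limOmegaOne, ((ρ (y η δ 0)).support : Set I) ⊆ J γ → δ.1 < β := by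
    intro γ
    obtain ⟨β, hβ⟩ := OmegaOne.exists_forall_lt
      (((hcount γ).image Subtype.val).union (Set.countable_singleton γ))
    exact ⟨β, hβ γ (Or.inr rfl), fun δ hδ => hβ _ (Or.inl ⟨δ, hδ, rfl⟩)⟩
  choose ψ hψ hψ' using hψ
  let e : ℕ → OmegaOne := fun n => ψ^[n] ⟨0, Ordinal.omega_pos 1⟩
  have hsucc : ∀ n, e (n + 1) = ψ (e n) := fun n => Function.iterate_succ_apply' _ _ _
  obtain ⟨δ, hδ, hlub⟩ := OmegaOne.exists_isLUB_mem_lim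
    (strictMono_nat_of_lt_succ fun n => by rw [hsucc]; exact hψ _ : StrictMono e)
  obtain ⟨n, hn⟩ := hsub ⟨δ, hδ⟩
  obtain ⟨_, ⟨k, rfl⟩, hk⟩ := (lt_isLUB_iff hlub).1 ((hη ⟨δ, hδ⟩).lt n)
  have h1 : δ < ψ (e k) := hψ' (e k) ⟨δ, hδ⟩ (hn.trans (hJmono hk.le))
  rw [← hsucc] at h1
  exact absurd (hlub.1 ⟨k + 1, rfl⟩) (not_le.2 h1)

theorem AllLadderSystemsUniformize.existsNonfreeCoseparable
    (h : AllLadderSystemsUniformize ℕ) : ExistsNonfreeCoseparable := by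
  choose η hη using fun δ : limOmegaOne => OmegaOne.exists_isLadder δ.2
  have hP := IsLadderSystem.isTame (η := η) hη (fun _ => tailSolvable_halvingRel)
    fun _ => rationallySolvable_halvingRel
  refine ⟨HalvingGroup η, inferInstance, mk_ladderSystemPresentation_group hP,
    hP.isStronglyAlephOneFree, ?_, HalvingGroup.not_free hη⟩
  refine LadderPresentation.isAlephOneCoseparable_of_exists_solution fun c => ?_
  -- Since ℤ^(ω) is countable, its elements can serve as colours. Uniformizing `-c` makes the ladder
  -- values equal to `-c` on a tail, as `exists_halving_solution` requires.
  let code : (ℕ →₀ ℤ) ≃ ℕ := (nonempty_equiv_of_countable (α := ℕ →₀ ℤ) (β := ℕ)).some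
  obtain ⟨f, fs, hf⟩ := h _ subset_rfl OmegaOne.isStationary_lim η hη
    fun δ n => code (-c (equivShrink _ δ) n)
  have hg : ∀ δ : limOmegaOne, ∃ g : ℕ → ℕ →₀ ℤ, ∀ m,
      relEval (fun i => code.symm (f (η δ i))) g (halvingRel m) = c (equivShrink _ δ) m :=
    fun δ => exists_halving_solution (fs δ) _ _ fun m hm => by
      rw [hf δ m hm, Equiv.symm_apply_apply]
  choose g hg using hg
  refine ⟨fun α => code.symm (f ((equivShrink _).symm α)),
    fun d => g ((equivShrink _).symm d), fun d m => ?_⟩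
  have := hg ((equivShrink _).symm d) m
  simpa [ladderSystemPresentation] using this

theorem theorem0p2 :
    (AllCoseparable → AllWhitehead) ∧
    (AllWhitehead → AllLadderSystemsUniformize (Fin 2)) ∧
    (AllLadderSystemsUniformize (Fin 2) ↔ AllLadderSystemsUniformize ℕ) ∧
    (AllLadderSystemsUniformize ℕ → ExistsNonfreeCoseparable) :=
  ⟨fun h A _ hA hA' => (h A hA hA').isWhitehead,
    AllWhitehead.allLadderSystemsUniformize_two,
    ⟨AllLadderSystemsUniformize.nat_of_two, AllLadderSystemsUniformize.two_of_nat⟩,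
    AllLadderSystemsUniformize.existsNonfreeCoseparable⟩
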